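/- Let $I\subseteq\mathbb R$ and $J\subseteq\mathbb R$ be nonempty open intervals, let $\mu\in C^\infty(I)$, and consider the Fokker--Planck--Kolmogorov equation of the time-homogeneous diffusion $dX_t=\mu(X_t)\,dt+dW_t$, $$ (\mathcal L-\partial_t)u=0,\qquad \mathcal L=\tfrac12\,\partial_x^2-\mu(x)\,\partial_x-\mu'(x),\qquad x\in I,\ t\in J. $$ A Lie symmetry of this equation is a smooth vector field $\xi(x,t)\,\partial_x+\tau(t)\,\partial_t+\alpha(x,t)\,u\,\partial_u$ on $I\times J\times\mathbb R$ together with a local one-parameter group $(x,t,u)\mapsto(\mathcal X,\mathcal T,u/f)$, $\mathcal X=\mathcal X^\epsilon(x,t)$, $\mathcal T=\mathcal T^\epsilon(t)$, $f=f^\epsilon(x,t)$, generated by it, such that for every $\epsilon$ and every local classical solution $\mathcal U$ of the equation the function $$ u(x,t)=f^\epsilon(x,t)\,\mathcal U\bigl(\mathcal X^\epsilon(x,t),\mathcal T^\epsilon(t)\bigr) $$ is again a solution where it is defined. It is trivial if $\xi\equiv 0$ and $\tau$ is constant (that is, if it only combines time translations with multiplication of $u$ by constants), and non-trivial otherwise.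 Then the equation has a non-trivial Lie symmetry if and only if, after a translation of the space coordinate (that is, with $\mu$ replaced by $\mu(\cdot+c)$ and $I$ by $I-c$ for some $c\in\mathbb R$), the drift $\mu$ solves one of the following Riccati equations on its interval for some real constants $A,B,C,D$: $$\mathscr F_1:\ \mu'+\mu^2=4Bx+2C,\qquad \mathscr F_2:\ \mu'+\mu^2=Ax^2+4Bx+2C,$$ $$\mathscr F_3:\ \mu'+\mu^2=2C+\frac{D}{x^2},\qquad \mathscr F_4:\ \mu'+\mu^2=Ax^2+2C+\frac{D}{x^2}$$ (in $\mathscr F_3$ and $\mathscr F_4$ the interval must not contain $0$ unless $D=0$). -/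

import Mathlib

open scoped ContDiff

/-- The spatial operator `L = (1/2) ∂²/∂x² - μ(x) ∂/∂x - μ'(x)` of the
Fokker-Planck-Kolmogorov equation of `dX = μ(X) dt + dW`, applied to `u(x,t)`. -/
noncomputable def fpkeOperator (μ : ℝ → ℝ) (u : ℝ → ℝ → ℝ) (x t : ℝ) : ℝ :=
  (1 / 2) * deriv (fun y => deriv (fun z => u z t) y) x
    - μ x * deriv (fun y => u y t) x - deriv μ x * u x t

/-- `u` is a classical (`C²`) solution of `(L - ∂_t) u = 0` on the set `Ω` of points `(x, t)`
(used for open `Ω`). -/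
def IsFPKESolutionOn (μ : ℝ → ℝ) (Ω : Set (ℝ × ℝ)) (u : ℝ → ℝ → ℝ) : Prop :=
  ContDiffOn ℝ 2 (fun p : ℝ × ℝ => u p.1 p.2) Ω ∧
    ∀ p ∈ Ω, fpkeOperator μ u p.1 p.2 - deriv (fun s => u p.1 s) p.2 = 0

/-- A Lie symmetry of the equation `(L - ∂_t) u = 0`, posed for `x ∈ I` and `t ∈ J`: a smooth
vector field `ξ(x,t) ∂_x + τ(t) ∂_t + α(x,t) u ∂_u` together with the local one-parameter
transformation group
`(x, t, u) ↦ (X, T, u / f)`, `X = X(ε,x,t)`, `T = T(ε,t)`, `f = f(ε,x,t)`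
that it generates, such that for every parameter `ε` and every solution `U` the function
`u(x,t) = f(x,t) U(X(x,t), T(t))` is again a solution where it is defined. -/
structure LieSymmetry (μ : ℝ → ℝ) (I J : Set ℝ) where
  /-- coefficient of `∂_x` -/
  ξ : ℝ → ℝ → ℝ
  /-- coefficient of `∂_t` -/
  τ : ℝ → ℝ
  /-- the coefficient of `∂_u` is `α(x,t) u` -/
  α : ℝ → ℝ → ℝ
  /-- the set of all `(ε, x, t)` for which the transformation is defined -/
  dom : Set (ℝ × ℝ × ℝ)
  /-- transformed space variable, as a function of `ε, x, t` -/
  X : ℝ → ℝ → ℝ → ℝ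
  /-- transformed time, as a function of `ε, t` -/
  T : ℝ → ℝ → ℝ
  /-- multiplier, as a function of `ε, x, t` -/
  f : ℝ → ℝ → ℝ → ℝ
  smooth_ξ : ContDiffOn ℝ ∞ (fun p : ℝ × ℝ => ξ p.1 p.2) (I ×ˢ J)
  smooth_τ : ContDiffOn ℝ ∞ τ J
  smooth_α : ContDiffOn ℝ ∞ (fun p : ℝ × ℝ => α p.1 p.2) (I ×ˢ J)
  -- the domain of a local flow on `I × J`
  isOpen_dom : IsOpen dom
  dom_subset : ∀ ε x t, (ε, x, t) ∈ dom → x ∈ I ∧ t ∈ J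
  zero_mem_dom : ∀ x ∈ I, ∀ t ∈ J, ((0 : ℝ), x, t) ∈ dom
  ordConnected_dom : ∀ x t, {ε : ℝ | (ε, x, t) ∈ dom}.OrdConnected
  maps_to : ∀ ε x t, (ε, x, t) ∈ dom → X ε x t ∈ I ∧ T ε t ∈ J
  -- smoothness of the transformations
  smooth_X : ContDiffOn ℝ ∞ (fun q : ℝ × ℝ × ℝ => X q.1 q.2.1 q.2.2) dom
  smooth_T : ContDiffOn ℝ ∞ (fun q : ℝ × ℝ × ℝ => T q.1 q.2.2) dom
  smooth_f : ContDiffOn ℝ ∞ (fun q : ℝ × ℝ × ℝ => f q.1 q.2.1 q.2.2) dom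
  -- exponentiation of the vector field: initial conditions and differential equations
  X_zero : ∀ x ∈ I, ∀ t ∈ J, X 0 x t = x
  T_zero : ∀ t ∈ J, T 0 t = t
  f_zero : ∀ x ∈ I, ∀ t ∈ J, f 0 x t = 1
  hasDerivAt_X : ∀ ε x t, (ε, x, t) ∈ dom →
    HasDerivAt (fun e => X e x t) (ξ (X ε x t) (T ε t)) ε
  hasDerivAt_T : ∀ ε x t, (ε, x, t) ∈ dom →
    HasDerivAt (fun e => T e t) (τ (T ε t)) ε
  -- the `u`-component `u / f` solves `dU/dε = α(X,T) U`
  hasDerivAt_f : ∀ ε x t, (ε, x, t) ∈ dom →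
    HasDerivAt (fun e => f e x t) (-α (X ε x t) (T ε t) * f ε x t) ε
  -- solutions are mapped to solutions
  maps_solutions : ∀ (ε : ℝ) (Ω : Set (ℝ × ℝ)) (U : ℝ → ℝ → ℝ),
    IsOpen Ω → Ω ⊆ I ×ˢ J → IsFPKESolutionOn μ Ω U →
      IsFPKESolutionOn μ {p | (ε, p.1, p.2) ∈ dom ∧ (X ε p.1 p.2, T ε p.2) ∈ Ω}
        (fun x t => f ε x t * U (X ε x t) (T ε t))

/-- The trivial symmetries, which every time-homogeneous equation has, are the combinations of
time translation and multiplication of `u` by constants, so they do not move `x` and shift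
`t` uniformly: `ξ = 0` and `τ` is constant. All other symmetries are non-trivial. -/
def LieSymmetry.Nontrivial {μ : ℝ → ℝ} {I J : Set ℝ} (S : LieSymmetry μ I J) : Prop :=
  ¬ ((∀ x ∈ I, ∀ t ∈ J, S.ξ x t = 0) ∧ ∃ c : ℝ, ∀ t ∈ J, S.τ t = c)

/-- `μ' + μ² = 4 B x + 2 C` on `I`. -/
def RiccatiF1 (μ : ℝ → ℝ) (I : Set ℝ) : Prop :=
  ∃ B C : ℝ, ∀ x ∈ I, deriv μ x + μ x ^ 2 = 4 * B * x + 2 * C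

/-- `μ' + μ² = A x² + 4 B x + 2 C` on `I`. -/
def RiccatiF2 (μ : ℝ → ℝ) (I : Set ℝ) : Prop :=
  ∃ A B C : ℝ, ∀ x ∈ I, deriv μ x + μ x ^ 2 = A * x ^ 2 + 4 * B * x + 2 * C

/-- `μ' + μ² = 2 C + D / x²` on `I`, where `I` does not contain `0` unless `D = 0`. -/
def RiccatiF3 (μ : ℝ → ℝ) (I : Set ℝ) : Prop :=
  ∃ C D : ℝ, (D = 0 ∨ (0 : ℝ) ∉ I) ∧
    ∀ x ∈ I, deriv μ x + μ x ^ 2 = 2 * C + D / x ^ 2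

/-- `μ' + μ² = A x² + 2 C + D / x²` on `I`, where `I` does not contain `0` unless `D = 0`. -/
def RiccatiF4 (μ : ℝ → ℝ) (I : Set ℝ) : Prop :=
  ∃ A C D : ℝ, (D = 0 ∨ (0 : ℝ) ∉ I) ∧
    ∀ x ∈ I, deriv μ x + μ x ^ 2 = A * x ^ 2 + 2 * C + D / x ^ 2

/-- `μ` solves on `I` a Riccati equation from one of the four families. -/
def SolvesRiccati (μ : ℝ → ℝ) (I : Set ℝ) : Prop :=
  RiccatiF1 μ I ∨ RiccatiF2 μ I ∨ RiccatiF3 μ I ∨ RiccatiF4 μ I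

/-!
Write `q = μ' + μ²`. If `M' = μ`, the substitution `u = exp(M) v` turns the equation into
`v_t = v_xx / 2 - q v / 2`, so only `q` matters; it has to be shown that a non-trivial symmetry
exists exactly when `q` is a quadratic polynomial or of the form
`A (x - c)² + 2 C + D / (x - c)²`.

**A symmetry restricts `q`.** The equation has local solutions `exp(l t) φ(x)`, where `φ` solves a
linear second-order equation; since `l` and the initial values of `φ` are free, these realize every
jet `(U, U_x, U_xx)` with `U ≠ 0` (`exists_local_solution`). Testing a symmetry on them gives
the three determining equations for `X`, `T`, `f` (`LieSymmetry.determining`), and their derivatives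
at `ε = 0` are the linear equations for `ξ`, `τ`, `α` (`LieSymmetry.linearized`). Consequently
`ξ = r(t) + s(t) (x - x₀)` with `s = τ' / 2`, and `α - μ ξ` is quadratic in `x`. Eliminating `α`
leaves, for every `t`,
`(r + s (x - x₀)) q' + 2 s q = k + 2 r'' (x - x₀) + s'' (x - x₀)²`
(`LieSymmetry.potential_equation`). Where `s ≠ 0` this integrates to a quadratic polynomial in
`x - c` plus `D / (x - c)²`; if `D ≠ 0`, comparing the equations at all times shows that `ξ` vanishes
at `x = c` for all `t` and hence that the linear term is absent. If `s ≡ 0`, then `q` is quadratic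
(`classify_potential`).

**Symmetries for the listed `q`.** By `exists_lieSymmetry` a group of affine maps in `x` over time
changes, with multiplier `exp(M(x) - M(X) + φ)`, is a symmetry once `φ` satisfies two
differential equations. For quadratic `q` the translations `x ↦ x + ε ρ(t)` with `ρ'' = A ρ` qualify
(`exists_nontrivial_of_quadratic`). For `q = A (x - c)² + 2 C + D / (x - c)²` the flow of `τ(t) ∂_t`
with `τ''' = 4 A τ'`, combined with the dilation of `x - c` by `√T_t`, qualifies
(`exists_nontrivial_of_inverseSquare`); the flow is explicit for each sign of `A`.
-/

open Filter Topology Set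

/-! ### The equation under a point transformation -/

/-- The partial derivatives in `z` of a function `U (z, s)` which is `C²` at a point, as
one-variable derivatives. -/
lemma ContDiffAt.hasDerivAt_slices {U : ℝ → ℝ → ℝ} {z s : ℝ}
    (hU : ContDiffAt ℝ 2 (fun p : ℝ × ℝ => U p.1 p.2) (z, s)) :
    (∀ᶠ y in 𝓝 z, HasDerivAt (fun w => U w s) (deriv (fun w => U w s) y) y) ∧
      HasDerivAt (fun y => deriv (fun w => U w s) y)
        (deriv (fun y => deriv (fun w => U w s) y) z) z := by
  have hslice : ContDiffAt ℝ 2 (fun w => U w s) z :=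
    ContDiffAt.comp (f := fun w : ℝ => (w, s)) (g := fun p : ℝ × ℝ => U p.1 p.2) z hU
      (contDiffAt_id.prodMk contDiffAt_const)
  constructor
  · filter_upwards [hslice.eventually (by simp)] with y hy
    exact (hy.differentiableAt (by simp)).hasDerivAt
  · have h1 : ContDiffAt ℝ 1 (deriv fun w => U w s) z :=
      (hslice.fderiv_right (m := 1) (by norm_num)).clm_apply contDiffAt_const
    exact (h1.differentiableAt (by simp)).hasDerivAt

/-- The operator `L - ∂_t` applied to `u(x,t) = f(x,t) U(X(x,t), T(t))`, by the chain rule. -/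
lemma fpkeOperator_sub_deriv_comp {μ : ℝ → ℝ} {U X f : ℝ → ℝ → ℝ} {T X₁ f₁ : ℝ → ℝ}
    {X₂ f₂ Xt ft Tt x t : ℝ}
    (hX : ∀ᶠ y in 𝓝 x, HasDerivAt (fun z => X z t) (X₁ y) y) (hX₁ : HasDerivAt X₁ X₂ x)
    (hXt : HasDerivAt (fun s => X x s) Xt t)
    (hf : ∀ᶠ y in 𝓝 x, HasDerivAt (fun z => f z t) (f₁ y) y) (hf₁ : HasDerivAt f₁ f₂ x)
    (hft : HasDerivAt (fun s => f x s) ft t) (hT : HasDerivAt T Tt t)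
    (hU : ContDiffAt ℝ 2 (fun p : ℝ × ℝ => U p.1 p.2) (X x t, T t)) :
    fpkeOperator μ (fun y s => f y s * U (X y s) (T s)) x t
        - deriv (fun s => f x s * U (X x s) (T s)) t =
      (1 / 2) * f x t * X₁ x ^ 2 *
          deriv (fun y => deriv (fun z => U z (T t)) y) (X x t)
        + (f₁ x * X₁ x + (1 / 2) * f x t * X₂ - μ x * f x t * X₁ x - f x t * Xt) *
          deriv (fun z => U z (T t)) (X x t)
        + ((1 / 2) * f₂ - μ x * f₁ x - deriv μ x * f x t - ft) * U (X x t) (T t)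
        - f x t * Tt * deriv (fun s => U (X x t) s) (T t) := by
  obtain ⟨hU₁, hU₂⟩ := hU.hasDerivAt_slices
  have hXc : Tendsto (fun y => X y t) (𝓝 x) (𝓝 (X x t)) := hX.self_of_nhds.continuousAt
  set D : ℝ → ℝ := deriv (fun w => U w (T t)) with hD
  -- first derivative in `x`, near `x`
  have hu₁ : ∀ᶠ y in 𝓝 x, HasDerivAt (fun z => f z t * U (X z t) (T t))
      (f₁ y * U (X y t) (T t) + f y t * (D (X y t) * X₁ y)) y := by
    filter_upwards [hX, hf, hXc.eventually hU₁] with y h1 h2 h3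
    exact h2.mul (HasDerivAt.comp (h := fun z => X z t) y h3 h1)
  have hu₂ : HasDerivAt (fun y => f₁ y * U (X y t) (T t) + f y t * (D (X y t) * X₁ y))
      (f₂ * U (X x t) (T t) + f₁ x * (D (X x t) * X₁ x) +
        (f₁ x * (D (X x t) * X₁ x) +
          f x t * (deriv D (X x t) * X₁ x * X₁ x + D (X x t) * X₂))) x := by
    have h3 := hU₁.self_of_nhds.comp x hX.self_of_nhds
    have h4 := HasDerivAt.comp x (h₂ := D) hU₂ hX.self_of_nhds
    exact (hf₁.mul h3).add (hf.self_of_nhds.mul (h4.mul hX₁))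
  -- derivative in `t`
  have hUd := (hU.differentiableAt (by simp)).hasFDerivAt
  set F := fderiv ℝ (fun p : ℝ × ℝ => U p.1 p.2) (X x t, T t)
  have hut : HasDerivAt (fun s => U (X x s) (T s)) (F (Xt, Tt)) t :=
    HasFDerivAt.comp_hasDerivAt (f := fun s => (X x s, T s)) t hUd (hXt.prodMk hT)
  have hFX : HasDerivAt (fun w => U w (T t)) (F (1, 0)) (X x t) :=
    HasFDerivAt.comp_hasDerivAt (f := fun w => (w, T t)) (X x t) hUd
      ((hasDerivAt_id _).prodMk (hasDerivAt_const _ _))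
  have hFT : HasDerivAt (fun s => U (X x t) s) (F (0, 1)) (T t) :=
    HasFDerivAt.comp_hasDerivAt (f := fun w => (X x t, w)) (T t) hUd
      ((hasDerivAt_const _ _).prodMk (hasDerivAt_id _))
  have hF : F (Xt, Tt) = Xt * D (X x t) + Tt * deriv (fun s => U (X x t) s) (T t) := by
    rw [hD, hFX.deriv, hFT.deriv, ← smul_eq_mul, ← smul_eq_mul, ← map_smul, ← map_smul, ← map_add]
    simp
  have e1 : deriv (fun y => deriv (fun z => f z t * U (X z t) (T t)) y) x = _ :=
    ((EventuallyEq.deriv_eq (hu₁.mono fun y hy => hy.deriv)).trans hu₂.deriv)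
  have e2 : deriv (fun s => f x s * U (X x s) (T s)) t = _ := (hft.mul hut).deriv
  rw [fpkeOperator, e1, e2, hu₁.self_of_nhds.deriv, hF]
  ring

/-! ### Separated local solutions -/

/-- Near every point of an open set where `μ` is smooth, the stationary equation
`φ'' = 2 μ φ' + 2 (μ' + l) φ` has a `C²` solution with prescribed value and derivative. -/
lemma exists_separated_profile {μ : ℝ → ℝ} {I : Set ℝ} (hI : IsOpen I)
    (hμ : ContDiffOn ℝ ∞ μ I) {z : ℝ} (hz : z ∈ I) (l a b : ℝ) :
    ∃ δ > 0, ∃ φ ψ : ℝ → ℝ, Ioo (z - δ) (z + δ) ⊆ I ∧ φ z = a ∧ ψ z = b ∧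
      (∀ x ∈ Ioo (z - δ) (z + δ), HasDerivAt φ (ψ x) x) ∧
      ∀ x ∈ Ioo (z - δ) (z + δ),
        HasDerivAt ψ (2 * μ x * ψ x + 2 * (deriv μ x + l) * φ x) x := by
  have hμz : ContDiffAt ℝ 1 μ z := (hμ.contDiffAt (hI.mem_nhds hz)).of_le (by simp)
  have hμz' : ContDiffAt ℝ 1 (deriv μ) z :=
    (((contDiffOn_infty_iff_deriv_of_isOpen hI).1 hμ).2.contDiffAt
      (hI.mem_nhds hz)).of_le (by simp)
  -- the equation as an autonomous system for `(x, φ, ψ)`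
  let v : ℝ × ℝ × ℝ → ℝ × ℝ × ℝ := fun p =>
    (1, p.2.2, 2 * μ p.1 * p.2.2 + 2 * (deriv μ p.1 + l) * p.2.1)
  have hv : ContDiffAt ℝ 1 v (z, a, b) := by
    have h1 : ContDiffAt ℝ 1 (fun p : ℝ × ℝ × ℝ => μ p.1) (z, a, b) :=
      ContDiffAt.comp (f := Prod.fst) (z, a, b) hμz contDiffAt_fst
    have h2 : ContDiffAt ℝ 1 (fun p : ℝ × ℝ × ℝ => deriv μ p.1) (z, a, b) :=
      ContDiffAt.comp (f := Prod.fst) (z, a, b) hμz' contDiffAt_fst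
    have h3 : ContDiffAt ℝ 1 (fun p : ℝ × ℝ × ℝ => p.2.1) (z, a, b) := by fun_prop
    have h4 : ContDiffAt ℝ 1 (fun p : ℝ × ℝ × ℝ => p.2.2) (z, a, b) := by fun_prop
    exact contDiffAt_const.prodMk (h4.prodMk
      (((contDiffAt_const.mul h1).mul h4).add
        ((contDiffAt_const.mul (h2.add contDiffAt_const)).mul h3)))
  obtain ⟨γ, hγz, ε, hε, hγ⟩ :=
    hv.exists_forall_mem_closedBall_exists_eq_forall_mem_Ioo_hasDerivAt₀ z
  obtain ⟨δ', hδ', hball⟩ := Metric.isOpen_iff.1 hI z hz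
  have h1 : ∀ x ∈ Ioo (z - ε) (z + ε), HasDerivAt (fun y => (γ y).1) 1 x := fun x hx =>
    (hγ x hx).fst
  -- the first component of the system is the independent variable itself
  have hfst : ∀ x ∈ Ioo (z - ε) (z + ε), (γ x).1 = x := by
    intro x hx
    have hzm : z ∈ Ioo (z - ε) (z + ε) := ⟨by linarith, by linarith⟩
    have := (isOpen_Ioo.is_const_of_deriv_eq_zero (f := fun y => (γ y).1 - y)
      isPreconnected_Ioo
      (fun y hy => ((h1 y hy).sub (hasDerivAt_id y)).differentiableAt.differentiableWithinAt)
      (fun y hy => ((h1 y hy).sub (hasDerivAt_id' y)).deriv.trans (sub_self _)) hx hzm)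
    simp only [hγz, sub_self] at this
    linarith
  refine ⟨min ε δ', lt_min hε hδ', fun x => (γ x).2.1, fun x => (γ x).2.2, ?_, by simp [hγz],
    by simp [hγz], ?_, ?_⟩
  · intro x hx
    apply hball
    rw [Metric.mem_ball, Real.dist_eq, abs_lt]
    have := min_le_right ε δ'
    constructor <;> linarith [hx.1, hx.2]
  all_goals
    intro x hx
    have hx' : x ∈ Ioo (z - ε) (z + ε) := by
      have := min_le_left ε δ'
      constructor <;> linarith [hx.1, hx.2]
  · exact (hγ x hx').snd.fst
  · have h := (hγ x hx').snd.snd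
    simp only [v, hfst x hx'] at h
    exact h

/-- Near every point `(z, s)` of `I ×ˢ J` the equation has a solution `U` whose jet at the point is
`U = a`, `U_x = b`, `U_t = l a` (the equation then determines `U_xx`). -/
lemma exists_local_solution {μ : ℝ → ℝ} {I J : Set ℝ} (hI : IsOpen I) (hJ : IsOpen J)
    (hμ : ContDiffOn ℝ ∞ μ I) {z s : ℝ} (hz : z ∈ I) (hs : s ∈ J) (l a b : ℝ) :
    ∃ (Ω : Set (ℝ × ℝ)) (U : ℝ → ℝ → ℝ), IsOpen Ω ∧ Ω ⊆ I ×ˢ J ∧ (z, s) ∈ Ω ∧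
      IsFPKESolutionOn μ Ω U ∧ U z s = a ∧ deriv (fun y => U y s) z = b ∧
      deriv (fun y => deriv (fun w => U w s) y) z = 2 * μ z * b + 2 * (deriv μ z + l) * a ∧
      deriv (fun r => U z r) s = l * a := by
  obtain ⟨δ, hδ, φ, ψ, hsub, hφz, hψz, hφ, hψ⟩ := exists_separated_profile hI hμ hz l a b
  set S := Ioo (z - δ) (z + δ) with hS
  have hzS : z ∈ S := ⟨by linarith, by linarith⟩
  have hSo : IsOpen S := isOpen_Ioo
  have hU₁ : ∀ y ∈ S, ∀ r,
      HasDerivAt (fun w => Real.exp (l * (r - s)) * φ w) (Real.exp (l * (r - s)) * ψ y) y :=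
    fun y hy r => (hφ y hy).const_mul _
  have hU₂ : ∀ y ∈ S, ∀ r,
      deriv (fun y => deriv (fun w => Real.exp (l * (r - s)) * φ w) y) y =
        Real.exp (l * (r - s)) * (2 * μ y * ψ y + 2 * (deriv μ y + l) * φ y) := by
    intro y hy r
    rw [EventuallyEq.deriv_eq (f := fun y => Real.exp (l * (r - s)) * ψ y)]
    · exact ((hψ y hy).const_mul _).deriv
    · filter_upwards [hSo.mem_nhds hy] with w hw using (hU₁ w hw r).deriv
  have hUt : ∀ y r, HasDerivAt (fun r => Real.exp (l * (r - s)) * φ y)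
      (l * (Real.exp (l * (r - s)) * φ y)) r := by
    intro y r
    have : HasDerivAt (fun r => l * (r - s)) l r := by
      simpa using ((hasDerivAt_id r).sub_const s).const_mul l
    exact (this.exp.mul_const (φ y)).congr_deriv (by ring)
  have hφC : ContDiffOn ℝ 2 φ S := by
    have hd : ∀ {g g' : ℝ → ℝ} {n : ℕ∞}, (∀ x ∈ S, HasDerivAt g (g' x) x) → ContDiffOn ℝ n g' S →
        ContDiffOn ℝ (n + 1) g S := by
      intro g g' n hg hg'
      refine (contDiffOn_succ_iff_deriv_of_isOpen hSo).2
        ⟨fun x hx => (hg x hx).differentiableAt.differentiableWithinAt, by simp,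
          hg'.congr fun x hx => (hg x hx).deriv⟩
    have hψ0 : ContDiffOn ℝ (0 : ℕ∞) ψ S := 
      contDiffOn_zero.2 fun x hx => (hψ x hx).continuousAt.continuousWithinAt
    have hφ0 : ContDiffOn ℝ (0 : ℕ∞) φ S := 
      contDiffOn_zero.2 fun x hx => (hφ x hx).continuousAt.continuousWithinAt
    have hμ0 : ContDiffOn ℝ (0 : ℕ∞) μ S := (hμ.mono hsub).of_le (by simp)
    have hμ1 : ContDiffOn ℝ (0 : ℕ∞) (deriv μ) S :=
      ((((contDiffOn_infty_iff_deriv_of_isOpen hI).1 hμ).2).mono hsub).of_le (by simp)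
    have hψ1 : ContDiffOn ℝ ((0 : ℕ∞) + 1) ψ S := hd hψ
      (((contDiffOn_const.mul hμ0).mul hψ0).add
        ((contDiffOn_const.mul (hμ1.add contDiffOn_const)).mul hφ0))
    have hψ1' : ContDiffOn ℝ (1 : ℕ∞) ψ S := by simpa using hψ1
    have := hd hφ hψ1'
    norm_num at this
    exact this
  refine ⟨S ×ˢ J, fun y r => Real.exp (l * (r - s)) * φ y, hSo.prod hJ,
    prod_mono hsub subset_rfl, ⟨hzS, hs⟩, ⟨?_, ?_⟩, by simp [hφz], ?_, ?_, ?_⟩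
  · have h1 : ContDiffOn ℝ 2 (fun p : ℝ × ℝ => φ p.1) (S ×ˢ J) :=
      hφC.comp contDiffOn_fst fun p hp => hp.1
    have h2 : ContDiffOn ℝ 2 (fun p : ℝ × ℝ => Real.exp (l * (p.2 - s))) (S ×ˢ J) := by fun_prop
    exact h2.mul h1
  · rintro ⟨y, r⟩ ⟨hy, -⟩
    simp only [fpkeOperator]
    rw [hU₂ y hy r, (hU₁ y hy r).deriv, (hUt y r).deriv]
    ring
  · rw [(hU₁ z hzS s).deriv]; simp [hψz]
  · rw [hU₂ z hzS s]; simp [hψz, hφz]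
  · rw [(hUt z s).deriv]; simp [hφz]

/-! ### Determining equations of a symmetry -/

/-- The derivative of a function `F (ε, x, t)` in the direction `v` of the `(x, t)`-plane. -/
noncomputable def pderiv (v : ℝ × ℝ) (F : ℝ × ℝ × ℝ → ℝ) (q : ℝ × ℝ × ℝ) : ℝ :=
  fderiv ℝ F q (0, v)

section pderiv

variable {D : Set (ℝ × ℝ × ℝ)} {F : ℝ × ℝ × ℝ → ℝ}

lemma ContDiffOn.fderiv_apply_of_isOpen {E : Type*} [NormedAddCommGroup E] [NormedSpace ℝ E]
    {s : Set E} {g : E → ℝ} (hs : IsOpen s) (hg : ContDiffOn ℝ ∞ g s) (w : E) :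
    ContDiffOn ℝ ∞ (fun q => fderiv ℝ g q w) s :=
  (hg.fderiv_of_isOpen hs (by simp)).clm_apply contDiffOn_const

lemma ContDiffOn.pderiv (hD : IsOpen D) (hF : ContDiffOn ℝ ∞ F D) (v : ℝ × ℝ) :
    ContDiffOn ℝ ∞ (pderiv v F) D :=
  hF.fderiv_apply_of_isOpen hD (0, v)

lemma ContDiffOn.hasFDerivAt_of_isOpen {E : Type*} [NormedAddCommGroup E] [NormedSpace ℝ E]
    {s : Set E} {g : E → ℝ} (hs : IsOpen s) (hg : ContDiffOn ℝ ∞ g s) {q : E}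
    (hq : q ∈ s) : HasFDerivAt g (fderiv ℝ g q) q :=
  ((hg.contDiffAt (hs.mem_nhds hq)).differentiableAt (by simp)).hasFDerivAt

lemma hasDerivAt_pderiv_fst (hD : IsOpen D) (hF : ContDiffOn ℝ ∞ F D) {ε x t : ℝ}
    (hq : (ε, x, t) ∈ D) : HasDerivAt (fun y => F (ε, y, t)) (pderiv (1, 0) F (ε, x, t)) x :=
  HasFDerivAt.comp_hasDerivAt (f := fun y => (ε, y, t)) x (hF.hasFDerivAt_of_isOpen hD hq)
    ((hasDerivAt_const _ _).prodMk ((hasDerivAt_id _).prodMk (hasDerivAt_const _ _)))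

lemma hasDerivAt_pderiv_snd (hD : IsOpen D) (hF : ContDiffOn ℝ ∞ F D) {ε x t : ℝ}
    (hq : (ε, x, t) ∈ D) : HasDerivAt (fun s => F (ε, x, s)) (pderiv (0, 1) F (ε, x, t)) t :=
  HasFDerivAt.comp_hasDerivAt (f := fun s => (ε, x, s)) t (hF.hasFDerivAt_of_isOpen hD hq)
    ((hasDerivAt_const _ _).prodMk ((hasDerivAt_const _ _).prodMk (hasDerivAt_id _)))

lemma eventually_hasDerivAt_pderiv_fst (hD : IsOpen D) (hF : ContDiffOn ℝ ∞ F D) {ε x t : ℝ}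
    (hq : (ε, x, t) ∈ D) :
    ∀ᶠ y in 𝓝 x, HasDerivAt (fun y => F (ε, y, t)) (pderiv (1, 0) F (ε, y, t)) y := by
  have hc : ContinuousAt (fun y : ℝ => (ε, y, t)) x := by fun_prop
  filter_upwards [hc (hD.mem_nhds hq)] with y hy using hasDerivAt_pderiv_fst hD hF hy

/-- The spatial derivatives at `ε = 0` are those of the restriction to `ε = 0`. -/
lemma pderiv_zero {R : Set (ℝ × ℝ)} (hR : IsOpen R) (hD : IsOpen D) (hF : ContDiffOn ℝ ∞ F D)
    (h0 : ∀ p ∈ R, ((0 : ℝ), p) ∈ D) {g : ℝ × ℝ → ℝ} (hg : ∀ p ∈ R, F (0, p) = g p)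
    (v : ℝ × ℝ) {p : ℝ × ℝ} (hp : p ∈ R) : pderiv v F (0, p) = fderiv ℝ g p v := by
  have h1 : HasFDerivAt (fun p : ℝ × ℝ => F (0, p))
      ((fderiv ℝ F (0, p)).comp (ContinuousLinearMap.inr ℝ ℝ (ℝ × ℝ))) p :=
    (hF.hasFDerivAt_of_isOpen hD (h0 p hp)).comp p (hasFDerivAt_prodMk_right (0 : ℝ) p)
  have h2 : (fun p : ℝ × ℝ => F (0, p)) =ᶠ[𝓝 p] g := by
    filter_upwards [hR.mem_nhds hp] with r hr using hg r hr
  rw [← h2.fderiv_eq, h1.fderiv]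
  rfl

/-- Differentiation in `ε` at `ε = 0` commutes with differentiation in `(x, t)`. -/
lemma hasDerivAt_pderiv_zero {R : Set (ℝ × ℝ)} (hR : IsOpen R) (hD : IsOpen D)
    (hF : ContDiffOn ℝ ∞ F D) (h0 : ∀ p ∈ R, ((0 : ℝ), p) ∈ D) {g : ℝ × ℝ → ℝ}
    (hg : ∀ p ∈ R, HasDerivAt (fun ε => F (ε, p)) (g p) 0) (v : ℝ × ℝ) {p : ℝ × ℝ}
    (hp : p ∈ R) : HasDerivAt (fun ε => pderiv v F (ε, p)) (fderiv ℝ g p v) 0 := by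
  have hcurve : ∀ p : ℝ × ℝ, HasDerivAt (fun ε : ℝ => (ε, p)) (1, 0) (0 : ℝ) := fun p =>
    (hasDerivAt_id _).prodMk (hasDerivAt_const _ _)
  have hg' : ∀ r ∈ R, fderiv ℝ F (0, r) (1, 0) = g r := fun r hr =>
    (HasFDerivAt.comp_hasDerivAt (f := fun ε : ℝ => (ε, r)) 0
      (hF.hasFDerivAt_of_isOpen hD (h0 r hr)) (hcurve r)).unique (hg r hr)
  have hsym := ((hF.contDiffAt (hD.mem_nhds (h0 p hp))).isSymmSndFDerivAt (n := ∞)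
    (by rw [minSmoothness_of_isRCLikeNormedField]; exact ENat.LEInfty.out))
    (1, 0) (0, v)
  have hF' : DifferentiableAt ℝ (fderiv ℝ F) (0, p) :=
    ((hF.contDiffAt (hD.mem_nhds (h0 p hp))).fderiv_right (m := ∞) le_rfl).differentiableAt
      (by simp)
  have hw : ∀ w, HasFDerivAt (fun q => fderiv ℝ F q w)
      ((fderiv ℝ (fderiv ℝ F) (0, p)).flip w) (0, p) := fun w => by
    simpa using hF'.hasFDerivAt.clm_apply (hasFDerivAt_const w _)
  have h1 : HasDerivAt (fun ε => pderiv v F (ε, p))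
      ((fderiv ℝ (fderiv ℝ F) (0, p)).flip (0, v) (1, 0)) 0 :=
    HasFDerivAt.comp_hasDerivAt (f := fun ε : ℝ => (ε, p)) 0 (hw (0, v)) (hcurve p)
  have h2 : HasFDerivAt (fun r : ℝ × ℝ => fderiv ℝ F (0, r) (1, 0))
      (((fderiv ℝ (fderiv ℝ F) (0, p)).flip (1, 0)).comp
        (ContinuousLinearMap.inr ℝ ℝ (ℝ × ℝ))) p :=
    (hw (1, 0)).comp p (hasFDerivAt_prodMk_right (0 : ℝ) p)
  have h3 : (fun r : ℝ × ℝ => fderiv ℝ F (0, r) (1, 0)) =ᶠ[𝓝 p] g := by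
    filter_upwards [hR.mem_nhds hp] with r hr using hg' r hr
  rw [← h3.fderiv_eq, h2.fderiv]
  refine h1.congr_deriv ?_
  simpa using hsym

end pderiv

namespace LieSymmetry

variable {μ : ℝ → ℝ} {I J : Set ℝ} (S : LieSymmetry μ I J)

/-- The transformed space variable as a function of `(ε, x, t)`. -/
def Xq (q : ℝ × ℝ × ℝ) : ℝ := S.X q.1 q.2.1 q.2.2

/-- The transformed time as a function of `(ε, x, t)`. -/
def Tq (q : ℝ × ℝ × ℝ) : ℝ := S.T q.1 q.2.2

/-- The multiplier as a function of `(ε, x, t)`. -/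
def fq (q : ℝ × ℝ × ℝ) : ℝ := S.f q.1 q.2.1 q.2.2

/-- Testing a symmetry on one local solution with prescribed jet `U = a`, `U_x = b`, `U_t = l a`
at the image point. -/
lemma jet_identity (hI : IsOpen I) (hJ : IsOpen J) (hμ : ContDiffOn ℝ ∞ μ I) {ε x t : ℝ}
    (hq : (ε, x, t) ∈ S.dom) (l a b : ℝ) :
    let q := (ε, x, t)
    (1 / 2) * S.fq q * pderiv (1, 0) S.Xq q ^ 2 *
        (2 * μ (S.Xq q) * b + 2 * (deriv μ (S.Xq q) + l) * a)
      + (pderiv (1, 0) S.fq q * pderiv (1, 0) S.Xq q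
        + (1 / 2) * S.fq q * pderiv (1, 0) (pderiv (1, 0) S.Xq) q
        - μ x * S.fq q * pderiv (1, 0) S.Xq q - S.fq q * pderiv (0, 1) S.Xq q) * b
      + ((1 / 2) * pderiv (1, 0) (pderiv (1, 0) S.fq) q - μ x * pderiv (1, 0) S.fq q
        - deriv μ x * S.fq q - pderiv (0, 1) S.fq q) * a
      - S.fq q * pderiv (0, 1) S.Tq q * (l * a) = 0 := by
  intro q
  have hD := S.isOpen_dom
  obtain ⟨hX, hT⟩ := S.maps_to _ _ _ hq
  obtain ⟨Ω, U, hΩ, hΩs, hm, hsol, h0, h1, h2, h3⟩ := exists_local_solution hI hJ hμ hX hT l a b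
  have key := (S.maps_solutions ε Ω U hΩ hΩs hsol).2 (x, t) ⟨hq, hm⟩
  have chain := fpkeOperator_sub_deriv_comp (μ := μ) (U := U) (X := S.X ε) (f := S.f ε)
    (T := S.T ε) (eventually_hasDerivAt_pderiv_fst hD S.smooth_X hq)
    (hasDerivAt_pderiv_fst hD (ContDiffOn.pderiv hD S.smooth_X (1, 0)) hq)
    (hasDerivAt_pderiv_snd hD S.smooth_X hq)
    (eventually_hasDerivAt_pderiv_fst hD S.smooth_f hq)
    (hasDerivAt_pderiv_fst hD (ContDiffOn.pderiv hD S.smooth_f (1, 0)) hq)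
    (hasDerivAt_pderiv_snd hD S.smooth_f hq)
    (hasDerivAt_pderiv_snd hD S.smooth_T hq) (hsol.1.contDiffAt (hΩ.mem_nhds hm))
  simp only at key
  rw [chain, h0, h1, h2, h3] at key
  exact key

/-- The determining equations: the image of every jet of a solution satisfies the equation, so the
coefficients of `U_xx`, `U_x` and `U` vanish separately. -/
lemma determining (hI : IsOpen I) (hJ : IsOpen J) (hμ : ContDiffOn ℝ ∞ μ I) {ε x t : ℝ}
    (hq : (ε, x, t) ∈ S.dom) :
    let q := (ε, x, t)
    S.fq q * pderiv (1, 0) S.Xq q ^ 2 - S.fq q * pderiv (0, 1) S.Tq q = 0 ∧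
    pderiv (1, 0) S.fq q * pderiv (1, 0) S.Xq q
        + (1 / 2) * S.fq q * pderiv (1, 0) (pderiv (1, 0) S.Xq) q
        + S.fq q * pderiv (1, 0) S.Xq q ^ 2 * μ (S.Xq q)
        - μ x * S.fq q * pderiv (1, 0) S.Xq q - S.fq q * pderiv (0, 1) S.Xq q = 0 ∧
    (1 / 2) * pderiv (1, 0) (pderiv (1, 0) S.fq) q
        + S.fq q * pderiv (1, 0) S.Xq q ^ 2 * deriv μ (S.Xq q)
        - μ x * pderiv (1, 0) S.fq q - deriv μ x * S.fq q - pderiv (0, 1) S.fq q = 0 := by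
  intro q
  have h1 := S.jet_identity hI hJ hμ hq 0 1 0
  have h2 := S.jet_identity hI hJ hμ hq 0 0 1
  have h3 := S.jet_identity hI hJ hμ hq 1 1 0
  simp only at h1 h2 h3
  refine ⟨?_, ?_, ?_⟩
  · linear_combination h3 - h1
  · linear_combination h2
  · linear_combination h1

section linearize

variable (hI : IsOpen I) (hJ : IsOpen J)
include hI hJ

/-- The vector field satisfies the linearizations at `ε = 0` of the determining equations. -/
lemma linearized (hμ : ContDiffOn ℝ ∞ μ I) {p : ℝ × ℝ} (hp : p ∈ I ×ˢ J) :
    let ξ := fun p : ℝ × ℝ => S.ξ p.1 p.2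
    let α := fun p : ℝ × ℝ => S.α p.1 p.2
    2 * fderiv ℝ ξ p (1, 0) = deriv S.τ p.2 ∧
    -fderiv ℝ α p (1, 0) + (1 / 2) * fderiv ℝ (fun r => fderiv ℝ ξ r (1, 0)) p (1, 0)
      + fderiv ℝ ξ p (1, 0) * μ p.1 + deriv μ p.1 * ξ p - fderiv ℝ ξ p (0, 1) = 0 ∧
    -(1 / 2) * fderiv ℝ (fun r => fderiv ℝ α r (1, 0)) p (1, 0)
      + 2 * fderiv ℝ ξ p (1, 0) * deriv μ p.1 + deriv (deriv μ) p.1 * ξ p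
      + μ p.1 * fderiv ℝ α p (1, 0) + fderiv ℝ α p (0, 1) = 0 := by
  intro ξ α
  have hD := S.isOpen_dom
  have hR : IsOpen (I ×ˢ J) := hI.prod hJ
  have h0 : ∀ p ∈ I ×ˢ J, ((0 : ℝ), p) ∈ S.dom := fun p hp => S.zero_mem_dom _ hp.1 _ hp.2
  have sX : ContDiffOn ℝ ∞ S.Xq S.dom := S.smooth_X
  have sT : ContDiffOn ℝ ∞ S.Tq S.dom := S.smooth_T
  have sf : ContDiffOn ℝ ∞ S.fq S.dom := S.smooth_f
  have sX1 := ContDiffOn.pderiv hD sX (1, 0)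
  have sf1 := ContDiffOn.pderiv hD sf (1, 0)
  -- values at `ε = 0`
  have vX : ∀ p ∈ I ×ˢ J, S.Xq (0, p) = p.1 := fun p hp => S.X_zero _ hp.1 _ hp.2
  have vf : ∀ p ∈ I ×ˢ J, S.fq (0, p) = 1 := fun p hp => S.f_zero _ hp.1 _ hp.2
  have vT : ∀ p ∈ I ×ˢ J, S.Tq (0, p) = p.2 := fun p hp => S.T_zero _ hp.2
  have vX' : ∀ v, ∀ p ∈ I ×ˢ J, pderiv v S.Xq (0, p) = v.1 := fun v p hp => by
    rw [pderiv_zero hR hD sX h0 vX v hp, fderiv_fst]; rfl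
  have vf' : ∀ v, ∀ p ∈ I ×ˢ J, pderiv v S.fq (0, p) = 0 := fun v p hp => by
    rw [pderiv_zero hR hD sf h0 vf v hp]; simp
  have vT' : ∀ v, ∀ p ∈ I ×ˢ J, pderiv v S.Tq (0, p) = v.2 := fun v p hp => by
    rw [pderiv_zero hR hD sT h0 vT v hp, fderiv_snd]; rfl
  have vX2 : pderiv (1, 0) (pderiv (1, 0) S.Xq) (0, p) = 0 := by
    rw [pderiv_zero hR hD sX1 h0 (vX' (1, 0)) (1, 0) hp]; simp
  have vf2 : pderiv (1, 0) (pderiv (1, 0) S.fq) (0, p) = 0 := by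
    rw [pderiv_zero hR hD sf1 h0 (vf' (1, 0)) (1, 0) hp]; simp
  -- derivatives in `ε` at `ε = 0`
  have dX : ∀ p ∈ I ×ˢ J, HasDerivAt (fun ε => S.Xq (ε, p)) (ξ p) 0 := fun p hp =>
    (S.hasDerivAt_X 0 p.1 p.2 (h0 p hp)).congr_deriv
      (by rw [S.X_zero _ hp.1 _ hp.2, S.T_zero _ hp.2])
  have dT : ∀ p ∈ I ×ˢ J, HasDerivAt (fun ε => S.Tq (ε, p)) (S.τ p.2) 0 := fun p hp =>
    (S.hasDerivAt_T 0 p.1 p.2 (h0 p hp)).congr_deriv (by rw [S.T_zero _ hp.2])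
  have df : ∀ p ∈ I ×ˢ J, HasDerivAt (fun ε => S.fq (ε, p)) (-α p) 0 := fun p hp =>
    (S.hasDerivAt_f 0 p.1 p.2 (h0 p hp)).congr_deriv
      (by rw [S.X_zero _ hp.1 _ hp.2, S.T_zero _ hp.2, S.f_zero _ hp.1 _ hp.2, mul_one])
  have neg : ∀ (g : ℝ × ℝ → ℝ) (r v : ℝ × ℝ),
      fderiv ℝ (fun p => -g p) r v = -fderiv ℝ g r v := fun g r v => by
    rw [fderiv_fun_neg]; rfl
  have dX' : ∀ v, ∀ p ∈ I ×ˢ J,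
      HasDerivAt (fun ε => pderiv v S.Xq (ε, p)) (fderiv ℝ ξ p v) 0 := fun v p hp =>
    hasDerivAt_pderiv_zero hR hD sX h0 dX v hp
  have df' : ∀ v, ∀ p ∈ I ×ˢ J,
      HasDerivAt (fun ε => pderiv v S.fq (ε, p)) (-fderiv ℝ α p v) 0 := fun v p hp => by
    have := hasDerivAt_pderiv_zero hR hD sf h0 df v hp
    rwa [neg] at this
  have dT' : HasDerivAt (fun ε => pderiv (0, 1) S.Tq (ε, p)) (deriv S.τ p.2) 0 := by
    have h1 := hasDerivAt_pderiv_zero hR hD sT h0 dT (0, 1) hp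
    have h2 : HasDerivAt S.τ (deriv S.τ p.2) p.2 :=
      ((S.smooth_τ.contDiffAt (hJ.mem_nhds hp.2)).differentiableAt (by simp)).hasDerivAt
    have h3 : HasFDerivAt (fun r : ℝ × ℝ => S.τ r.2)
        (deriv S.τ p.2 • ContinuousLinearMap.snd ℝ ℝ ℝ) p :=
      HasDerivAt.comp_hasFDerivAt (f := Prod.snd) p h2 hasFDerivAt_snd
    rw [h3.fderiv] at h1
    simpa using h1
  have dX2 := hasDerivAt_pderiv_zero hR hD sX1 h0 (dX' (1, 0)) (1, 0) hp
  have df2 := hasDerivAt_pderiv_zero hR hD sf1 h0 (df' (1, 0)) (1, 0) hp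
  rw [neg] at df2
  have hμ' : ContDiffOn ℝ ∞ (deriv μ) I := ((contDiffOn_infty_iff_deriv_of_isOpen hI).1 hμ).2
  have dμ : HasDerivAt (fun ε => μ (S.Xq (ε, p))) (deriv μ p.1 * ξ p) 0 := by
    have h : HasDerivAt μ (deriv μ p.1) (S.Xq (0, p)) := by
      rw [vX p hp]
      exact ((hμ.contDiffAt (hI.mem_nhds hp.1)).differentiableAt (by simp)).hasDerivAt
    exact HasDerivAt.comp (h := fun ε => S.Xq (ε, p)) 0 h (dX p hp)
  have dμ' : HasDerivAt (fun ε => deriv μ (S.Xq (ε, p))) (deriv (deriv μ) p.1 * ξ p) 0 := by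
    have h : HasDerivAt (deriv μ) (deriv (deriv μ) p.1) (S.Xq (0, p)) := by
      rw [vX p hp]
      exact ((hμ'.contDiffAt (hI.mem_nhds hp.1)).differentiableAt (by simp)).hasDerivAt
    exact HasDerivAt.comp (h := fun ε => S.Xq (ε, p)) 0 h (dX p hp)
  have hev : ∀ᶠ ε : ℝ in 𝓝 0, (ε, p.1, p.2) ∈ S.dom := by
    have hc : ContinuousAt (fun ε : ℝ => (ε, p)) 0 := by fun_prop
    exact hc (hD.mem_nhds (h0 p hp))
  -- a function of `ε` vanishing on the domain has derivative zero
  have zero : ∀ {g : ℝ → ℝ} {g' : ℝ}, HasDerivAt g g' 0 →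
      (∀ ε, (ε, p.1, p.2) ∈ S.dom → g ε = 0) → g' = 0 := by
    intro g g' hg h
    have : g =ᶠ[𝓝 0] fun _ => 0 := hev.mono h
    rw [← hg.deriv, this.deriv_eq, deriv_const]
  have E1 := zero (((df p hp).mul ((dX' (1, 0) p hp).pow 2)).sub ((df p hp).mul dT'))
    fun ε hε => (S.determining hI hJ hμ hε).1
  have E2 := zero ((((((df' (1, 0) p hp).mul (dX' (1, 0) p hp)).add
    (((df p hp).const_mul (1 / 2)).mul dX2)).add
    (((df p hp).mul ((dX' (1, 0) p hp).pow 2)).mul dμ)).sub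
    (((df p hp).const_mul (μ p.1)).mul (dX' (1, 0) p hp))).sub
    ((df p hp).mul (dX' (0, 1) p hp)))
    fun ε hε => (S.determining hI hJ hμ hε).2.1
  have E3 := zero (((((df2.const_mul (1 / 2)).add
    (((df p hp).mul ((dX' (1, 0) p hp).pow 2)).mul dμ')).sub
    ((df' (1, 0) p hp).const_mul (μ p.1))).sub ((df p hp).const_mul (deriv μ p.1))).sub
    (df' (0, 1) p hp))
    fun ε hε => (S.determining hI hJ hμ hε).2.2
  simp only [vX p hp, vf p hp, vX' _ p hp, vf' _ p hp, vT' _ p hp, vX2, Pi.mul_apply,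
    Pi.pow_apply] at E1 E2 E3
  refine ⟨?_, ?_, ?_⟩
  · norm_num at E1
    linear_combination E1
  · norm_num at E2
    linear_combination E2
  · norm_num at E3
    linear_combination E3

end linearize

end LieSymmetry

/-! ### The equation for the potential -/

lemma eq_of_hasDerivAt_zero {I : Set ℝ} (hI : IsOpen I) (hI' : I.OrdConnected) {g : ℝ → ℝ}
    (hg : ∀ x ∈ I, HasDerivAt g 0 x) {x y : ℝ} (hx : x ∈ I) (hy : y ∈ I) : g x = g y :=
  hI.is_const_of_deriv_eq_zero hI'.isPreconnected
    (fun z hz => (hg z hz).differentiableAt.differentiableWithinAt) (fun z hz => (hg z hz).deriv)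
    hx hy

lemma ContDiffOn.hasDerivAt_of_isOpen {I : Set ℝ} (hI : IsOpen I) {g : ℝ → ℝ}
    (hg : ContDiffOn ℝ ∞ g I) {x : ℝ} (hx : x ∈ I) : HasDerivAt g (deriv g x) x :=
  ((hg.contDiffAt (hI.mem_nhds hx)).differentiableAt (by simp)).hasDerivAt

lemma ContDiffOn.deriv_of_isOpen_infty {I : Set ℝ} (hI : IsOpen I) {g : ℝ → ℝ}
    (hg : ContDiffOn ℝ ∞ g I) : ContDiffOn ℝ ∞ (deriv g) I :=
  ((contDiffOn_infty_iff_deriv_of_isOpen hI).1 hg).2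

lemma HasFDerivAt.hasDerivAt_fst {g : ℝ × ℝ → ℝ} {L : ℝ × ℝ →L[ℝ] ℝ} {x t : ℝ}
    (h : HasFDerivAt g L (x, t)) : HasDerivAt (fun y => g (y, t)) (L (1, 0)) x :=
  HasFDerivAt.comp_hasDerivAt (f := fun y => (y, t)) x h
    ((hasDerivAt_id _).prodMk (hasDerivAt_const _ _))

lemma HasFDerivAt.hasDerivAt_snd {g : ℝ × ℝ → ℝ} {L : ℝ × ℝ →L[ℝ] ℝ} {x t : ℝ}
    (h : HasFDerivAt g L (x, t)) : HasDerivAt (fun s => g (x, s)) (L (0, 1)) t :=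
  HasFDerivAt.comp_hasDerivAt (f := fun s => (x, s)) t h
    ((hasDerivAt_const _ _).prodMk (hasDerivAt_id _))

namespace LieSymmetry

variable {μ : ℝ → ℝ} {I J : Set ℝ} (S : LieSymmetry μ I J)

lemma contDiffOn_ξ_slice {x₀ : ℝ} (hx₀ : x₀ ∈ I) : ContDiffOn ℝ ∞ (fun t => S.ξ x₀ t) J :=
  S.smooth_ξ.comp (f := fun t : ℝ => (x₀, t)) (by fun_prop) fun _ ht => ⟨hx₀, ht⟩

/-- The coefficient `ξ` is affine in `x`, with slope `τ' / 2`. -/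
lemma ξ_eq_affine (hI : IsOpen I) (hI' : I.OrdConnected) (hJ : IsOpen J)
    (hμ : ContDiffOn ℝ ∞ μ I) {x₀ : ℝ} (hx₀ : x₀ ∈ I) {x t : ℝ} (hx : x ∈ I) (ht : t ∈ J) :
    S.ξ x t = S.ξ x₀ t + deriv S.τ t / 2 * (x - x₀) := by
  have hR : IsOpen (I ×ˢ J) := hI.prod hJ
  have h : ∀ y ∈ I, HasDerivAt (fun y => S.ξ y t - deriv S.τ t / 2 * (y - x₀)) 0 y := by
    intro y hy
    have hp : (y, t) ∈ I ×ˢ J := ⟨hy, ht⟩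
    have h1 := (ContDiffOn.hasFDerivAt_of_isOpen hR S.smooth_ξ hp).hasDerivAt_fst
    have h2 := (S.linearized hI hJ hμ hp).1
    refine (h1.sub (((hasDerivAt_id y).sub_const x₀).const_mul (deriv S.τ t / 2))).congr_deriv ?_
    linear_combination h2 / 2
  have := eq_of_hasDerivAt_zero hI hI' h hx hx₀
  linear_combination this

/-- For every time the function `q = μ' + μ²` solves a first-order linear equation in `x` whose
right-hand side is a quadratic polynomial. It comes from eliminating the mixed derivative `α_{xt}`
from the linearized determining equations. -/
lemma potential_equation (hI : IsOpen I) (hI' : I.OrdConnected) (hJ : IsOpen J)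
    (hμ : ContDiffOn ℝ ∞ μ I) {x₀ : ℝ} (hx₀ : x₀ ∈ I) {r s : ℝ → ℝ}
    (hr : r = fun t => S.ξ x₀ t) (hs : s = fun t => deriv S.τ t / 2) :
    ∃ k : ℝ → ℝ, ∀ t ∈ J, ∀ x ∈ I,
      (r t + s t * (x - x₀)) * (deriv (deriv μ) x + 2 * μ x * deriv μ x)
          + 2 * s t * (deriv μ x + μ x ^ 2) =
        k t + 2 * deriv (deriv r) t * (x - x₀) + deriv (deriv s) t * (x - x₀) ^ 2 := by
  have hR : IsOpen (I ×ˢ J) := hI.prod hJ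
  have hμ' := ContDiffOn.deriv_of_isOpen_infty hI hμ
  have hrC : ContDiffOn ℝ ∞ r J := hr ▸ S.contDiffOn_ξ_slice hx₀
  have hsC : ContDiffOn ℝ ∞ s J := hs ▸
    (ContDiffOn.deriv_of_isOpen_infty hJ S.smooth_τ).div_const 2
  have hr'C := ContDiffOn.deriv_of_isOpen_infty hJ hrC
  have hs'C := ContDiffOn.deriv_of_isOpen_infty hJ hsC
  set ξ := fun p : ℝ × ℝ => S.ξ p.1 p.2 with hξ
  set α := fun p : ℝ × ℝ => S.α p.1 p.2 with hα
  have hξe : ∀ x ∈ I, ∀ t ∈ J, ξ (x, t) = r t + s t * (x - x₀) := fun x hx t ht => by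
    rw [hr, hs]; exact S.ξ_eq_affine hI hI' hJ hμ hx₀ hx ht
  have hξx : ∀ p ∈ I ×ˢ J, fderiv ℝ ξ p (1, 0) = s p.2 := fun p hp => by
    rw [hs]; linear_combination (S.linearized hI hJ hμ hp).1 / 2
  have hξt : ∀ x ∈ I, ∀ t ∈ J,
      HasDerivAt (fun t => ξ (x, t)) (deriv r t + deriv s t * (x - x₀)) t := fun x hx t ht =>
    ((ContDiffOn.hasDerivAt_of_isOpen hJ hrC ht).add
      ((ContDiffOn.hasDerivAt_of_isOpen hJ hsC ht).mul_const _)).congr_of_eventuallyEq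
      (by filter_upwards [hJ.mem_nhds ht] with t' ht' using hξe x hx t' ht')
  have hξt' : ∀ x ∈ I, ∀ t ∈ J, fderiv ℝ ξ (x, t) (0, 1) = deriv r t + deriv s t * (x - x₀) :=
    fun x hx t ht => (ContDiffOn.hasFDerivAt_of_isOpen hR S.smooth_ξ
      (q := (x, t)) ⟨hx, ht⟩).hasDerivAt_snd.unique (hξt x hx t ht)
  have hξxx : ∀ x ∈ I, ∀ t ∈ J, fderiv ℝ (fun r => fderiv ℝ ξ r (1, 0)) (x, t) (1, 0) = 0 := by
    intro x hx t ht
    have h1 := (ContDiffOn.hasFDerivAt_of_isOpen hR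
      (S.smooth_ξ.fderiv_apply_of_isOpen hR (1, 0)) (q := (x, t)) ⟨hx, ht⟩).hasDerivAt_fst
    refine h1.unique ((hasDerivAt_const x (s t)).congr_of_eventuallyEq ?_)
    filter_upwards [hI.mem_nhds hx] with y hy using hξx (y, t) ⟨hy, ht⟩
  have hαx : ∀ x ∈ I, ∀ t ∈ J, fderiv ℝ α (x, t) (1, 0) =
      s t * μ x + deriv μ x * (r t + s t * (x - x₀)) - (deriv r t + deriv s t * (x - x₀)) := by
    intro x hx t ht
    have h : -fderiv ℝ α (x, t) (1, 0)
        + (1 / 2) * fderiv ℝ (fun r => fderiv ℝ ξ r (1, 0)) (x, t) (1, 0)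
        + fderiv ℝ ξ (x, t) (1, 0) * μ x + deriv μ x * ξ (x, t) - fderiv ℝ ξ (x, t) (0, 1) = 0 :=
      (S.linearized hI hJ hμ (p := (x, t)) ⟨hx, ht⟩).2.1
    rw [hξxx x hx t ht, hξx _ ⟨hx, ht⟩, hξt' x hx t ht, hξe x hx t ht] at h
    linear_combination -h
  have hαxx : ∀ x ∈ I, ∀ t ∈ J, fderiv ℝ (fun r => fderiv ℝ α r (1, 0)) (x, t) (1, 0) =
      s t * deriv μ x + (deriv (deriv μ) x * (r t + s t * (x - x₀)) + deriv μ x * s t)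
        - deriv s t := by
    intro x hx t ht
    have h1 := (ContDiffOn.hasFDerivAt_of_isOpen hR
      (S.smooth_α.fderiv_apply_of_isOpen hR (1, 0)) (q := (x, t)) ⟨hx, ht⟩).hasDerivAt_fst
    have hlin : ∀ a b : ℝ, HasDerivAt (fun y => a + b * (y - x₀)) b x := fun a b => by
      simpa using (((hasDerivAt_id x).sub_const x₀).const_mul b).const_add a
    have h2 := ((((ContDiffOn.hasDerivAt_of_isOpen hI hμ hx).const_mul (s t)).add
      ((ContDiffOn.hasDerivAt_of_isOpen hI hμ' hx).mul (hlin (r t) (s t)))).sub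
      (hlin (deriv r t) (deriv s t)))
    refine h1.unique (h2.congr_of_eventuallyEq ?_)
    filter_upwards [hI.mem_nhds hx] with y hy using hαx y hy t ht
  -- `β = α - μ ξ` is quadratic in `x`, since `β_x = -ξ_t`
  have hβ : ∀ x ∈ I, ∀ t ∈ J, α (x, t) - μ x * ξ (x, t) = α (x₀, t) - μ x₀ * ξ (x₀, t)
      - deriv r t * (x - x₀) - deriv s t / 2 * (x - x₀) ^ 2 := by
    intro x hx t ht
    have h : ∀ y ∈ I, HasDerivAt (fun y => α (y, t) - μ y * ξ (y, t) + deriv r t * (y - x₀)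
        + deriv s t / 2 * (y - x₀) ^ 2) 0 y := by
      intro y hy
      have h1 := (ContDiffOn.hasFDerivAt_of_isOpen hR S.smooth_α
        (q := (y, t)) ⟨hy, ht⟩).hasDerivAt_fst
      have h2 := (ContDiffOn.hasFDerivAt_of_isOpen hR S.smooth_ξ
        (q := (y, t)) ⟨hy, ht⟩).hasDerivAt_fst
      have h3 := (hasDerivAt_id' y).sub_const x₀
      refine (((h1.sub ((ContDiffOn.hasDerivAt_of_isOpen hI hμ hy).mul h2)).add
        (h3.const_mul (deriv r t))).add ((h3.pow 2).const_mul (deriv s t / 2))).congr_deriv ?_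
      change fderiv ℝ α (y, t) (1, 0) - (deriv μ y * ξ (y, t) +
        μ y * fderiv ℝ ξ (y, t) (1, 0)) + _ + _ = 0
      rw [hαx y hy t ht, hξe y hy t ht, hξx _ ⟨hy, ht⟩]
      push_cast
      ring
    have := eq_of_hasDerivAt_zero hI hI' h hx hx₀
    linear_combination this
  have hβt : ∀ x ∈ I, ∀ t ∈ J, HasDerivAt (fun t => α (x, t) - μ x * ξ (x, t))
      (fderiv ℝ α (x, t) (0, 1) - μ x * (deriv r t + deriv s t * (x - x₀))) t :=
    fun x hx t ht => (ContDiffOn.hasFDerivAt_of_isOpen hR S.smooth_α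
      (q := (x, t)) ⟨hx, ht⟩).hasDerivAt_snd.sub ((hξt x hx t ht).const_mul (μ x))
  refine ⟨fun t => -deriv s t - 2 * (fderiv ℝ α (x₀, t) (0, 1)
    - μ x₀ * (deriv r t + deriv s t * (x₀ - x₀))), fun t ht x hx => ?_⟩
  have h1 : HasDerivAt (fun t => α (x, t) - μ x * ξ (x, t)) _ t :=
    (((hβt x₀ hx₀ t ht).sub ((ContDiffOn.hasDerivAt_of_isOpen hJ hr'C ht).mul_const (x - x₀))).sub
      (((ContDiffOn.hasDerivAt_of_isOpen hJ hs'C ht).div_const 2).mul_const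
        ((x - x₀) ^ 2))).congr_of_eventuallyEq
    (by filter_upwards [hJ.mem_nhds ht] with t' ht' using hβ x hx t' ht')
  have h2 := (hβt x hx t ht).unique h1
  have h3 : -(1 / 2) * fderiv ℝ (fun r => fderiv ℝ α r (1, 0)) (x, t) (1, 0)
      + 2 * fderiv ℝ ξ (x, t) (1, 0) * deriv μ x + deriv (deriv μ) x * ξ (x, t)
      + μ x * fderiv ℝ α (x, t) (1, 0) + fderiv ℝ α (x, t) (0, 1) = 0 :=
    (S.linearized hI hJ hμ (p := (x, t)) ⟨hx, ht⟩).2.2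
  rw [hαxx x hx t ht, hξx _ ⟨hx, ht⟩, hξe x hx t ht, hαx x hx t ht] at h3
  linear_combination 2 * h3 - 2 * h2

end LieSymmetry

/-! ### Classification of the potentials -/

lemma deriv_deriv_eq_zero_of_eqOn {J : Set ℝ} (hJ : IsOpen J) {g : ℝ → ℝ}
    (hg : ∀ t ∈ J, g t = 0) {t : ℝ} (ht : t ∈ J) : deriv (deriv g) t = 0 := by
  have h : ∀ {g : ℝ → ℝ}, (∀ t ∈ J, g t = 0) → ∀ t ∈ J, deriv g t = 0 := fun {g} hg t ht => by
    rw [EventuallyEq.deriv_eq (f := fun _ => 0)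
      (by filter_upwards [hJ.mem_nhds ht] with t' ht' using hg t' ht'), deriv_const]
  exact h (h hg) t ht

lemma deriv_deriv_add_mul_const {J : Set ℝ} (hJ : IsOpen J) {r s : ℝ → ℝ}
    (hr : ContDiffOn ℝ ∞ r J) (hs : ContDiffOn ℝ ∞ s J) (c : ℝ) {t : ℝ} (ht : t ∈ J) :
    deriv (deriv fun t => r t + s t * c) t = deriv (deriv r) t + deriv (deriv s) t * c := by
  have h1 : ∀ {r s : ℝ → ℝ}, ContDiffOn ℝ ∞ r J → ContDiffOn ℝ ∞ s J → ∀ t ∈ J,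
      deriv (fun t => r t + s t * c) t = deriv r t + deriv s t * c := fun hr hs t ht =>
    ((ContDiffOn.hasDerivAt_of_isOpen hJ hr ht).add
      ((ContDiffOn.hasDerivAt_of_isOpen hJ hs ht).mul_const c)).deriv
  rw [EventuallyEq.deriv_eq
    (by filter_upwards [hJ.mem_nhds ht] with t' ht' using h1 hr hs t' ht')]
  exact h1 (ContDiffOn.deriv_of_isOpen_infty hJ hr) (ContDiffOn.deriv_of_isOpen_infty hJ hs) t ht

lemma const_eq_zero_of_infinite {Y : Set ℝ} (hY : Y.Infinite) {c₀ c₃ c₄ c₅ : ℝ}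
    (h : ∀ y ∈ Y, c₀ + c₃ * y ^ 3 + c₄ * y ^ 4 + c₅ * y ^ 5 = 0) : c₀ = 0 := by
  open Polynomial in
  have hp : (C c₀ + C c₃ * X ^ 3 + C c₄ * X ^ 4 + C c₅ * X ^ 5 : ℝ[X]) = 0 := by
    refine Polynomial.eq_zero_of_infinite_isRoot _ (hY.mono fun y hy => ?_)
    simpa [Polynomial.IsRoot] using h y hy
  simpa using congrArg (Polynomial.eval 0) hp

/-- The solutions `q` of the family of equations of `LieSymmetry.potential_equation`. If `s ≠ 0` at
some time, the equation at that time determines `q` up to a multiple `D (x - c)⁻²` of the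
homogeneous solution, and for `D ≠ 0` the equations at all other times force the linear term to
vanish. If `s` vanishes identically, then `q` is quadratic. -/
lemma classify_potential {I J : Set ℝ} (hI : IsOpen I) (hI' : I.OrdConnected) (hJ : IsOpen J)
    {q q' r s k : ℝ → ℝ} (hq : ∀ x ∈ I, HasDerivAt q (q' x) x) (hr : ContDiffOn ℝ ∞ r J)
    (hs : ContDiffOn ℝ ∞ s J) {x₀ : ℝ} (hx₀ : x₀ ∈ I)
    (heq : ∀ t ∈ J, ∀ x ∈ I, (r t + s t * (x - x₀)) * q' x + 2 * s t * q x =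
      k t + 2 * deriv (deriv r) t * (x - x₀) + deriv (deriv s) t * (x - x₀) ^ 2)
    {t₀ : ℝ} (ht₀ : t₀ ∈ J) (hne : s t₀ ≠ 0 ∨ ((∀ t ∈ J, s t = 0) ∧ r t₀ ≠ 0)) :
    (∃ A B C : ℝ, ∀ x ∈ I, q x = A * x ^ 2 + 4 * B * x + 2 * C) ∨
      ∃ c A C D : ℝ, c ∉ I ∧ ∀ x ∈ I, q x = A * (x - c) ^ 2 + 2 * C + D / (x - c) ^ 2 := by
  rcases hne with hs₀ | ⟨hs0, hr₀⟩
  · set c := x₀ - r t₀ / s t₀ with hc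
    set b : ℝ → ℝ := fun t => r t + s t * (c - x₀) with hb
    have hb₀ : b t₀ = 0 := by simp only [hb, hc]; field_simp; ring
    -- the right-hand side, expanded around `c`
    set m : ℝ → ℝ := fun t => k t + 2 * deriv (deriv r) t * (c - x₀)
      + deriv (deriv s) t * (c - x₀) ^ 2
    have heq' : ∀ t ∈ J, ∀ x ∈ I, (b t + s t * (x - c)) * q' x + 2 * s t * q x =
        m t + 2 * deriv (deriv b) t * (x - c) + deriv (deriv s) t * (x - c) ^ 2 := by
      intro t ht x hx
      rw [hb, deriv_deriv_add_mul_const hJ hr hs _ ht]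
      linear_combination heq t ht x hx
    set m₀ := m t₀
    set m₁ := 2 * deriv (deriv b) t₀ with hm₁
    set m₂ := deriv (deriv s) t₀
    have e₀ : ∀ x ∈ I, s t₀ * (x - c) * q' x + 2 * s t₀ * q x =
        m₀ + m₁ * (x - c) + m₂ * (x - c) ^ 2 := by
      intro x hx
      have := heq' t₀ ht₀ x hx
      rw [hb₀] at this
      linear_combination this
    clear_value m₀ m₁ m₂ c
    obtain ⟨D, hD⟩ : ∃ D, ∀ x ∈ I, (x - c) ^ 2 * q x = D + m₀ / (2 * s t₀) * (x - c) ^ 2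
        + m₁ / (3 * s t₀) * (x - c) ^ 3 + m₂ / (4 * s t₀) * (x - c) ^ 4 := by
      have h : ∀ x ∈ I, HasDerivAt (fun x => (x - c) ^ 2 * q x - m₀ / (2 * s t₀) * (x - c) ^ 2
          - m₁ / (3 * s t₀) * (x - c) ^ 3 - m₂ / (4 * s t₀) * (x - c) ^ 4) 0 x := by
        intro x hx
        have h3 := (hasDerivAt_id' x).sub_const c
        refine (((((h3.pow 2).mul (hq x hx)).sub ((h3.pow 2).const_mul _)).sub
          ((h3.pow 3).const_mul _)).sub ((h3.pow 4).const_mul _)).congr_deriv ?_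
        have := e₀ x hx
        simp only [Pi.pow_apply]
        push_cast
        field_simp
        linear_combination (x - c) * this
      exact ⟨(x₀ - c) ^ 2 * q x₀ - m₀ / (2 * s t₀) * (x₀ - c) ^ 2
        - m₁ / (3 * s t₀) * (x₀ - c) ^ 3 - m₂ / (4 * s t₀) * (x₀ - c) ^ 4, fun x hx => by
        have := eq_of_hasDerivAt_zero hI hI' h hx hx₀
        linear_combination this⟩
    have hquad : D = 0 → ∃ A B C : ℝ, ∀ x ∈ I, q x = A * x ^ 2 + 4 * B * x + 2 * C := by
      intro hD0
      have h : ∀ x ∈ I, q x = m₀ / (2 * s t₀) + m₁ / (3 * s t₀) * (x - c)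
          + m₂ / (4 * s t₀) * (x - c) ^ 2 := by
        intro x hx
        rcases eq_or_ne x c with hxc | hxc
        · have := e₀ x hx
          rw [hxc] at this ⊢
          field_simp
          linear_combination 12 * this
        · have hxc' := sub_ne_zero.2 hxc
          refine mul_left_cancel₀ (pow_ne_zero 2 hxc') ?_
          rw [hD x hx, hD0]
          ring
      refine ⟨m₂ / (4 * s t₀), (m₁ / (3 * s t₀) - 2 * c * (m₂ / (4 * s t₀))) / 4,
        (m₀ / (2 * s t₀) - m₁ / (3 * s t₀) * c + m₂ / (4 * s t₀) * c ^ 2) / 2,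
        fun x hx => ?_⟩
      rw [h x hx]
      ring
    by_cases hcI : c ∈ I
    · left
      exact hquad (by simpa using (hD c hcI).symm)
    rcases eq_or_ne D 0 with hD0 | hD0
    · exact Or.inl (hquad hD0)
    right
    have hxc : ∀ x ∈ I, x - c ≠ 0 := fun x hx h => hcI (by rwa [← sub_eq_zero.1 h])
    have hinf : ((fun x => x - c) '' I).Infinite :=
      (infinite_of_mem_nhds x₀ (hI.mem_nhds hx₀)).image (sub_left_injective.injOn)
    -- the term `-2 b D (x - c)⁻³` cannot be compensated
    have hb0 : ∀ t ∈ J, b t = 0 := by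
      intro t ht
      have : -2 * b t * D * s t₀ = 0 := by
        refine const_eq_zero_of_infinite hinf
          (c₃ := s t * m₀ + b t * m₁ - 2 * b t * m₁ / 3 - m t * s t₀)
          (c₄ := s t * m₁ + b t * m₂ - b t * m₂ / 2 - 2 * deriv (deriv b) t * s t₀)
          (c₅ := s t * m₂ - deriv (deriv s) t * s t₀) ?_
        rintro _ ⟨x, hx, rfl⟩
        have h1 := heq' t ht x hx
        have h2 := e₀ x hx
        have h3 := hD x hx
        have h3' : s t₀ * ((x - c) ^ 2 * q x) = s t₀ * D + m₀ / 2 * (x - c) ^ 2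
            + m₁ / 3 * (x - c) ^ 3 + m₂ / 4 * (x - c) ^ 4 := by
          rw [h3]; field_simp
        simp only
        linear_combination s t₀ * (x - c) ^ 3 * h1 - (x - c) ^ 2 * (b t + s t * (x - c)) * h2
          + 2 * b t * h3'
      have h2 : -2 * D * s t₀ ≠ 0 := by positivity
      exact (mul_eq_zero.1 (show (-2 * D * s t₀) * b t = 0 by linear_combination this)).resolve_left
        h2
    have hm₁0 : m₁ = 0 := by rw [hm₁, deriv_deriv_eq_zero_of_eqOn hJ hb0 ht₀, mul_zero]
    refine ⟨c, m₂ / (4 * s t₀), m₀ / (4 * s t₀), D, hcI, fun x hx => ?_⟩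
    refine mul_left_cancel₀ (pow_ne_zero 2 (hxc x hx)) ?_
    have := hxc x hx
    rw [hD x hx, hm₁0]
    field_simp
    ring
  · left
    have h : ∀ x ∈ I, HasDerivAt (fun x => q x - k t₀ / r t₀ * (x - x₀)
        - deriv (deriv r) t₀ / r t₀ * (x - x₀) ^ 2) 0 x := by
      intro x hx
      have h3 := (hasDerivAt_id' x).sub_const x₀
      refine (((hq x hx).sub (h3.const_mul _)).sub ((h3.pow 2).const_mul _)).congr_deriv ?_
      have := heq t₀ ht₀ x hx
      rw [hs0 t₀ ht₀, deriv_deriv_eq_zero_of_eqOn hJ hs0 ht₀] at this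
      push_cast
      field_simp
      linear_combination this
    refine ⟨deriv (deriv r) t₀ / r t₀,
      (k t₀ / r t₀ - 2 * x₀ * (deriv (deriv r) t₀ / r t₀)) / 4,
      (q x₀ - k t₀ / r t₀ * x₀ + deriv (deriv r) t₀ / r t₀ * x₀ ^ 2) / 2, fun x hx => ?_⟩
    have := eq_of_hasDerivAt_zero hI hI' h hx hx₀
    simp only [sub_self] at this
    linear_combination this

/-- The drift of an equation with a non-trivial symmetry solves a Riccati equation. -/
lemma LieSymmetry.Nontrivial.riccati {μ : ℝ → ℝ} {I J : Set ℝ} (hI : IsOpen I)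
    (hI' : I.OrdConnected) (hI'' : I.Nonempty) (hJ : IsOpen J) (hJ' : J.OrdConnected)
    (hμ : ContDiffOn ℝ ∞ μ I) {S : LieSymmetry μ I J} (hS : S.Nontrivial) :
    (∃ A B C : ℝ, ∀ x ∈ I, deriv μ x + μ x ^ 2 = A * x ^ 2 + 4 * B * x + 2 * C) ∨
      ∃ c A C D : ℝ, c ∉ I ∧
        ∀ x ∈ I, deriv μ x + μ x ^ 2 = A * (x - c) ^ 2 + 2 * C + D / (x - c) ^ 2 := by
  obtain ⟨x₀, hx₀⟩ := hI''
  obtain ⟨k, hk⟩ := S.potential_equation hI hI' hJ hμ hx₀ rfl rfl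
  have hμ' := ContDiffOn.deriv_of_isOpen_infty hI hμ
  have hq : ∀ x ∈ I, HasDerivAt (fun x => deriv μ x + μ x ^ 2)
      (deriv (deriv μ) x + 2 * μ x * deriv μ x) x := fun x hx =>
    ((ContDiffOn.hasDerivAt_of_isOpen hI hμ' hx).add
      ((ContDiffOn.hasDerivAt_of_isOpen hI hμ hx).pow 2)).congr_deriv (by push_cast; ring)
  have main := fun t₀ ht₀ => classify_potential hI hI' hJ hq (S.contDiffOn_ξ_slice hx₀)
    ((ContDiffOn.deriv_of_isOpen_infty hJ S.smooth_τ).div_const 2) hx₀ hk (t₀ := t₀) ht₀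
  by_cases hτ : ∃ t ∈ J, deriv S.τ t / 2 ≠ 0
  · obtain ⟨t₀, ht₀, h⟩ := hτ
    exact main t₀ ht₀ (Or.inl h)
  push Not at hτ
  by_cases hr : ∃ t ∈ J, S.ξ x₀ t ≠ 0
  · obtain ⟨t₀, ht₀, h⟩ := hr
    exact main t₀ ht₀ (Or.inr ⟨hτ, h⟩)
  push Not at hr
  refine absurd ⟨fun x hx t ht => ?_, ?_⟩ hS
  · rw [S.ξ_eq_affine hI hI' hJ hμ hx₀ hx ht, hr t ht, hτ t ht]; ring
  · rcases J.eq_empty_or_nonempty with rfl | ⟨t₀, ht₀⟩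
    · exact ⟨0, by simp⟩
    · refine ⟨S.τ t₀, fun t ht => eq_of_hasDerivAt_zero hJ hJ' (fun t ht => ?_) ht ht₀⟩
      exact (ContDiffOn.hasDerivAt_of_isOpen hJ S.smooth_τ ht).congr_deriv
        (by linarith [hτ t ht])

/-! ### Building a symmetry from its transformation group -/

lemma exists_antideriv {μ : ℝ → ℝ} {I : Set ℝ} (hI : IsOpen I) (hI' : I.OrdConnected)
    (hμ : ContDiffOn ℝ ∞ μ I) :
    ∃ M : ℝ → ℝ, ContDiffOn ℝ ∞ M I ∧ ∀ x ∈ I, HasDerivAt M (μ x) x := by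
  rcases I.eq_empty_or_nonempty with rfl | ⟨x₀, hx₀⟩
  · exact ⟨0, contDiffOn_const, by simp⟩
  have h : ∀ x ∈ I, HasDerivAt (fun x => ∫ y in x₀..x, μ y) (μ x) x := by
    intro x hx
    have hc : ContinuousOn μ (uIcc x₀ x) := hμ.continuousOn.mono (hI'.uIcc_subset hx₀ hx)
    exact intervalIntegral.integral_hasDerivAt_right hc.intervalIntegrable
      (hμ.continuousOn.stronglyMeasurableAtFilter hI x hx)
      (hμ.continuousOn.continuousAt (hI.mem_nhds hx))
  refine ⟨_, (contDiffOn_infty_iff_deriv_of_isOpen hI).2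
    ⟨fun x hx => (h x hx).differentiableAt.differentiableWithinAt,
      hμ.congr fun x hx => (h x hx).deriv⟩, h⟩

/-- The points `(ε, x, t)` such that the whole segment from `(0, x, t)` to `(ε, x, t)` lies
in `G`. -/
def starCore (G : Set (ℝ × ℝ × ℝ)) : Set (ℝ × ℝ × ℝ) :=
  {q | ∀ s ∈ Icc (0 : ℝ) 1, (s * q.1, q.2) ∈ G}

lemma isOpen_starCore {G : Set (ℝ × ℝ × ℝ)} (hG : IsOpen G) : IsOpen (starCore G) := by
  refine isOpen_iff_mem_nhds.2 fun q hq => ?_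
  refine isCompact_Icc.eventually_forall_of_forall_eventually
    (P := fun (q : ℝ × ℝ × ℝ) (s : ℝ) => (s * q.1, q.2) ∈ G) fun s hs => ?_
  have hc : ContinuousAt (fun z : (ℝ × ℝ × ℝ) × ℝ => (z.2 * z.1.1, z.1.2)) (q, s) := by fun_prop
  exact hc (hG.mem_nhds (hq s hs))

lemma starCore_subset (G : Set (ℝ × ℝ × ℝ)) : starCore G ⊆ G := fun q hq => by
  simpa using hq 1 (by simp)

lemma zero_mem_starCore {G : Set (ℝ × ℝ × ℝ)} {p : ℝ × ℝ} (hp : (0, p) ∈ G) :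
    (0, p) ∈ starCore G := fun s _ => by simpa using hp

lemma mul_mem_starCore {G : Set (ℝ × ℝ × ℝ)} {ε : ℝ} {p : ℝ × ℝ} (h : (ε, p) ∈ starCore G)
    {s : ℝ} (hs : s ∈ Icc (0 : ℝ) 1) : (s * ε, p) ∈ starCore G := fun r hr => by
  have := h (r * s) ⟨mul_nonneg hr.1 hs.1, mul_le_one₀ hr.2 hs.1 hs.2⟩
  simpa [mul_assoc] using this

lemma ordConnected_starCore (G : Set (ℝ × ℝ × ℝ)) (p : ℝ × ℝ) :
    {ε : ℝ | (ε, p) ∈ starCore G}.OrdConnected := by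
  -- `ε` between `0` and a member is a member
  have key : ∀ {ε₁ ε : ℝ}, (ε₁, p) ∈ starCore G → (0 ≤ ε ∧ ε ≤ ε₁ ∨ ε₁ ≤ ε ∧ ε ≤ 0) →
      (ε, p) ∈ starCore G := by
    intro ε₁ ε h hε
    rcases eq_or_ne ε₁ 0 with rfl | h0
    · have : ε = 0 := by rcases hε with h | h <;> linarith [h.1, h.2]
      rwa [this]
    · have := mul_mem_starCore h (s := ε / ε₁) (by
        rcases hε with h | h
        · exact ⟨div_nonneg h.1 (h.1.trans h.2), div_le_one_of_le₀ h.2 (h.1.trans h.2)⟩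
        · exact ⟨div_nonneg_of_nonpos h.2 (h.1.trans h.2),
            div_le_one_of_ge h.1 (h.1.trans h.2)⟩)
      rwa [div_mul_cancel₀ _ h0] at this
  refine ⟨fun ε₁ h₁ ε₂ h₂ ε hε => ?_⟩
  rcases le_total 0 ε with h | h
  · exact key h₂ (Or.inl ⟨h, hε.2⟩)
  · exact key h₁ (Or.inr ⟨hε.1, h⟩)

/-- A local transformation group `(X, T)` with `X` affine in `x` with slope `a`, `T_t = a²`, and
multiplier `exp (M x - M X + φ)`, where `M' = μ`, is a symmetry, if `φ` satisfies `X_t = a φ_x` and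
`φ_t = φ_xx / 2 + φ_x² / 2 - q(x) / 2 + a² q(X) / 2` with `q = μ' + μ²`. The factor `exp M`
conjugates the equation to the heat equation with potential `q / 2`. -/
lemma exists_lieSymmetry {μ : ℝ → ℝ} {I J : Set ℝ} (hI : IsOpen I) (hI' : I.OrdConnected)
    (hJ : IsOpen J) (hμ : ContDiffOn ℝ ∞ μ I) {G : Set (ℝ × ℝ × ℝ)} (hG : IsOpen G)
    (hG0 : ∀ x ∈ I, ∀ t ∈ J, ((0 : ℝ), x, t) ∈ G)
    {X φ φ₁ : ℝ → ℝ → ℝ → ℝ} {T a φ₂ : ℝ → ℝ → ℝ} {ξ α₀ : ℝ → ℝ → ℝ} {τ : ℝ → ℝ}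
    (sξ : ContDiff ℝ ∞ fun p : ℝ × ℝ => ξ p.1 p.2) (sτ : ContDiff ℝ ∞ τ)
    (sα : ContDiff ℝ ∞ fun p : ℝ × ℝ => α₀ p.1 p.2)
    (sX : ContDiffOn ℝ ∞ (fun q : ℝ × ℝ × ℝ => X q.1 q.2.1 q.2.2) G)
    (sT : ContDiffOn ℝ ∞ (fun q : ℝ × ℝ × ℝ => T q.1 q.2.2) G)
    (sφ : ContDiffOn ℝ ∞ (fun q : ℝ × ℝ × ℝ => φ q.1 q.2.1 q.2.2) G)
    (X0 : ∀ x t, X 0 x t = x) (T0 : ∀ t, T 0 t = t) (φ0 : ∀ x t, φ 0 x t = 0)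
    (Xx : ∀ ε x t, (ε, x, t) ∈ G → HasDerivAt (fun y => X ε y t) (a ε t) x)
    (Xt : ∀ ε x t, (ε, x, t) ∈ G → HasDerivAt (fun s => X ε x s) (φ₁ ε x t * a ε t) t)
    (Tt : ∀ ε x t, (ε, x, t) ∈ G → HasDerivAt (fun s => T ε s) (a ε t ^ 2) t)
    (φx : ∀ ε x t, (ε, x, t) ∈ G → HasDerivAt (fun y => φ ε y t) (φ₁ ε x t) x)
    (φxx : ∀ ε x t, (ε, x, t) ∈ G → HasDerivAt (fun y => φ₁ ε y t) (φ₂ ε t) x)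
    (φt : ∀ ε x t, (ε, x, t) ∈ G → x ∈ I → X ε x t ∈ I → HasDerivAt (fun s => φ ε x s)
      (φ₂ ε t / 2 + φ₁ ε x t ^ 2 / 2 - (deriv μ x + μ x ^ 2) / 2
        + a ε t ^ 2 * (deriv μ (X ε x t) + μ (X ε x t) ^ 2) / 2) t)
    (Xε : ∀ ε x t, (ε, x, t) ∈ G → HasDerivAt (fun e => X e x t) (ξ (X ε x t) (T ε t)) ε)
    (Tε : ∀ ε x t, (ε, x, t) ∈ G → HasDerivAt (fun e => T e t) (τ (T ε t)) ε)
    (φε : ∀ ε x t, (ε, x, t) ∈ G → HasDerivAt (fun e => φ e x t) (-α₀ (X ε x t) (T ε t)) ε) :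
    ∃ S : LieSymmetry μ I J, S.ξ = ξ ∧ S.τ = τ := by
  obtain ⟨M, hM, hMd⟩ := exists_antideriv hI hI' hμ
  have hμ' := ContDiffOn.deriv_of_isOpen_infty hI hμ
  set G' : Set (ℝ × ℝ × ℝ) := (G ∩ (fun q => (X q.1 q.2.1 q.2.2, T q.1 q.2.2)) ⁻¹' (I ×ˢ J)) ∩
    Prod.snd ⁻¹' (I ×ˢ J) with hG'
  have hG'o : IsOpen G' := ((sX.prodMk sT).continuousOn.isOpen_inter_preimage hG
    (hI.prod hJ)).inter ((hI.prod hJ).preimage continuous_snd)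
  have hD := isOpen_starCore hG'o
  set D := starCore G'
  have hDG' : D ⊆ G' := starCore_subset G'
  have hDG : D ⊆ G := fun q hq => (hDG' hq).1.1
  set f : ℝ → ℝ → ℝ → ℝ := fun ε x t => Real.exp (M x - M (X ε x t) + φ ε x t) with hf
  have sf : ContDiffOn ℝ ∞ (fun q : ℝ × ℝ × ℝ => f q.1 q.2.1 q.2.2) D := by
    have h1 : ContDiffOn ℝ ∞ (fun q : ℝ × ℝ × ℝ => M q.2.1) D :=
      hM.comp (f := fun q : ℝ × ℝ × ℝ => q.2.1) (by fun_prop) fun q hq => (hDG' hq).2.1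
    have h2 : ContDiffOn ℝ ∞ (fun q : ℝ × ℝ × ℝ => M (X q.1 q.2.1 q.2.2)) D :=
      hM.comp (sX.mono hDG) fun q hq => (hDG' hq).1.2.1
    exact ((h1.sub h2).add (sφ.mono hDG)).exp
  refine ⟨{
    ξ := ξ
    τ := τ
    α := fun x t => μ x * ξ x t + α₀ x t
    dom := D
    X := X
    T := T
    f := f
    smooth_ξ := sξ.contDiffOn
    smooth_τ := sτ.contDiffOn
    smooth_α := ?_
    isOpen_dom := hD
    dom_subset := fun ε x t h => (hDG' h).2
    zero_mem_dom := fun x hx t ht => zero_mem_starCore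
      ⟨⟨hG0 x hx t ht, by simpa [X0, T0] using ⟨hx, ht⟩⟩, hx, ht⟩
    ordConnected_dom := fun x t => ordConnected_starCore G' (x, t)
    maps_to := fun ε x t h => (hDG' h).1.2
    smooth_X := sX.mono hDG
    smooth_T := sT.mono hDG
    smooth_f := sf
    X_zero := fun x _ t _ => X0 x t
    T_zero := fun t _ => T0 t
    f_zero := fun x _ t _ => by simp [hf, X0, φ0]
    hasDerivAt_X := fun ε x t h => Xε ε x t (hDG h)
    hasDerivAt_T := fun ε x t h => Tε ε x t (hDG h)
    hasDerivAt_f := ?_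
    maps_solutions := ?_ }, rfl, rfl⟩
  · have h1 : ContDiffOn ℝ ∞ (fun p : ℝ × ℝ => μ p.1) (I ×ˢ J) :=
      hμ.comp contDiffOn_fst fun p hp => hp.1
    exact (h1.mul sξ.contDiffOn).add sα.contDiffOn
  · intro ε x t h
    have h1 := (hMd _ (hDG' h).1.2.1).comp ε (Xε ε x t (hDG h))
    exact (((h1.const_sub (M x)).add (φε ε x t (hDG h))).exp).congr_deriv (by simp [hf]; ring)
  · intro ε Ω U hΩ hΩs hU
    have hslice : ContDiff ℝ 2 (fun p : ℝ × ℝ => (ε, p)) := by fun_prop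
    set W : Set (ℝ × ℝ) := {p | (ε, p.1, p.2) ∈ D ∧ (X ε p.1 p.2, T ε p.2) ∈ Ω}
    have hW : MapsTo (fun p : ℝ × ℝ => (ε, p)) W D := fun p hp => hp.1
    have le : (2 : ℕ∞ω) ≤ ∞ := ENat.LEInfty.out
    refine ⟨?_, ?_⟩
    · have h1 : ContDiffOn ℝ 2 (fun p : ℝ × ℝ => f ε p.1 p.2) W :=
        (sf.of_le le).comp hslice.contDiffOn hW
      have h2 : ContDiffOn ℝ 2 (fun p : ℝ × ℝ => (X ε p.1 p.2, T ε p.2)) W :=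
        (((sX.prodMk sT).mono hDG).of_le le).comp hslice.contDiffOn hW
      exact h1.mul (hU.1.comp h2 fun p hp => hp.2)
    · rintro ⟨x, t⟩ ⟨hD', hm⟩
      simp only at hD' hm
      have hq := hDG hD'
      have hx : x ∈ I := (hDG' hD').2.1
      have hXI : X ε x t ∈ I := (hDG' hD').1.2.1
      have hnear : ∀ᶠ y in 𝓝 x, (ε, y, t) ∈ D := by
        have hc : ContinuousAt (fun y : ℝ => (ε, y, t)) x := by fun_prop
        exact hc (hD.mem_nhds hD')
      have hf₁ : ∀ y, (ε, y, t) ∈ D → HasDerivAt (fun y => f ε y t)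
          (f ε y t * (μ y - μ (X ε y t) * a ε t + φ₁ ε y t)) y := fun y hy =>
        (((hMd y (hDG' hy).2.1).sub ((hMd _ (hDG' hy).1.2.1).comp y (Xx ε y t (hDG hy)))).add
          (φx ε y t (hDG hy))).exp
      have hf₂ : HasDerivAt (fun y => f ε y t * (μ y - μ (X ε y t) * a ε t + φ₁ ε y t))
          (f ε x t * (μ x - μ (X ε x t) * a ε t + φ₁ ε x t) *
            (μ x - μ (X ε x t) * a ε t + φ₁ ε x t) +
            f ε x t * (deriv μ x - deriv μ (X ε x t) * a ε t * a ε t + φ₂ ε t)) x :=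
        (hf₁ x hD').mul (((ContDiffOn.hasDerivAt_of_isOpen hI hμ hx).sub
          (((ContDiffOn.hasDerivAt_of_isOpen hI hμ hXI).comp x (Xx ε x t hq)).mul_const _)).add
          (φxx ε x t hq))
      have hft : HasDerivAt (fun s => f ε x s) _ t :=
        ((((hMd _ hXI).comp t (Xt ε x t hq)).const_sub (M x)).add (φt ε x t hq hx hXI)).exp
      have chain := fpkeOperator_sub_deriv_comp (μ := μ) (U := U) (X := X ε) (f := f ε) (T := T ε)
        (hnear.mono fun y hy => Xx ε y t (hDG hy)) (hasDerivAt_const x (a ε t)) (Xt ε x t hq)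
        (hnear.mono hf₁) hf₂ hft (Tt ε x t hq) (hU.1.contDiffAt (hΩ.mem_nhds hm))
      have hUeq := hU.2 _ hm
      simp only [fpkeOperator] at hUeq
      simp only
      rw [chain]
      simp only [Function.comp_apply]
      change _ + (_ * U _ _) - _ = _
      set fv := Real.exp (M x - M (X ε x t) + φ ε x t) with hfv
      have hfv' : f ε x t = fv := rfl
      rw [hfv']
      linear_combination fv * a ε t ^ 2 * hUeq

/-! ### Quadratic potentials: space translations -/

lemma exists_oscillator (A B t₀ : ℝ) : ∃ ρ ρ' σ : ℝ → ℝ, ContDiff ℝ ∞ ρ ∧ ContDiff ℝ ∞ ρ' ∧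
    ContDiff ℝ ∞ σ ∧ (∀ t, HasDerivAt ρ (ρ' t) t) ∧ (∀ t, HasDerivAt ρ' (A * ρ t) t) ∧
    (∀ t, HasDerivAt σ (-2 * B * ρ t) t) ∧ ρ t₀ ≠ 0 := by
  suffices h : ∃ ρ ρ' θ : ℝ → ℝ, ContDiff ℝ ∞ ρ ∧ ContDiff ℝ ∞ ρ' ∧
      ContDiff ℝ ∞ θ ∧ (∀ t, HasDerivAt ρ (ρ' t) t) ∧ (∀ t, HasDerivAt ρ' (A * ρ t) t) ∧
      (∀ t, HasDerivAt θ (ρ t) t) ∧ ρ t₀ ≠ 0 by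
    obtain ⟨ρ, ρ', θ, h1, h2, h3, h4, h5, h6, h7⟩ := h
    exact ⟨ρ, ρ', fun t => -2 * B * θ t, h1, h2, contDiff_const.mul h3, h4, h5,
      fun t => (h6 t).const_mul _, h7⟩
  rcases lt_trichotomy A 0 with hA | rfl | hA
  · obtain ⟨k, hk, rfl⟩ : ∃ k : ℝ, k ≠ 0 ∧ A = -k ^ 2 :=
      ⟨√(-A), (Real.sqrt_pos.2 (by linarith)).ne', by rw [Real.sq_sqrt (by linarith)]; ring⟩
    have hl : ∀ t, HasDerivAt (fun t => k * (t - t₀)) k t := fun t => by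
      simpa using ((hasDerivAt_id t).sub_const t₀).const_mul k
    refine ⟨fun t => Real.cos (k * (t - t₀)), fun t => -Real.sin (k * (t - t₀)) * k,
      fun t => Real.sin (k * (t - t₀)) / k, by fun_prop, by fun_prop, by fun_prop,
      fun t => (hl t).cos, fun t => ((hl t).sin.neg.mul_const k).congr_deriv (by ring),
      fun t => ((hl t).sin.div_const k).congr_deriv (by field_simp), by simp⟩
  · refine ⟨fun _ => 1, fun _ => 0, fun t => t, by fun_prop, by fun_prop, by fun_prop,
      fun t => hasDerivAt_const _ _, fun t => by simpa using hasDerivAt_const t (0 : ℝ),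
      fun t => hasDerivAt_id t, by simp⟩
  · obtain ⟨k, hk, rfl⟩ : ∃ k : ℝ, k ≠ 0 ∧ A = k ^ 2 :=
      ⟨√A, (Real.sqrt_pos.2 hA).ne', (Real.sq_sqrt hA.le).symm⟩
    have hl : ∀ t, HasDerivAt (fun t => k * t) k t := fun t => by
      simpa using (hasDerivAt_id t).const_mul k
    refine ⟨fun t => Real.exp (k * t), fun t => Real.exp (k * t) * k,
      fun t => Real.exp (k * t) / k, by fun_prop, by fun_prop, by fun_prop,
      fun t => (hl t).exp, fun t => ((hl t).exp.mul_const k).congr_deriv (by ring),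
      fun t => ((hl t).exp.div_const k).congr_deriv (by field_simp), by positivity⟩

/-- For a quadratic potential the translations `x ↦ x + ε ρ(t)` with `ρ'' = A ρ` are
symmetries. -/
lemma exists_nontrivial_of_quadratic {μ : ℝ → ℝ} {I J : Set ℝ} (hI : IsOpen I)
    (hI' : I.OrdConnected) (hI'' : I.Nonempty) (hJ : IsOpen J) (hJ'' : J.Nonempty)
    (hμ : ContDiffOn ℝ ∞ μ I) {A B C : ℝ}
    (hq : ∀ x ∈ I, deriv μ x + μ x ^ 2 = A * x ^ 2 + 4 * B * x + 2 * C) :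
    ∃ S : LieSymmetry μ I J, S.Nontrivial := by
  obtain ⟨x₀, hx₀⟩ := hI''
  obtain ⟨t₀, ht₀⟩ := hJ''
  obtain ⟨ρ, ρ', σ, sρ, sρ', sσ, dρ, dρ', dσ, hρ⟩ := exists_oscillator A B t₀
  obtain ⟨S, hS, -⟩ : ∃ S : LieSymmetry μ I J, S.ξ = (fun _ t => ρ t) ∧ S.τ = fun _ => 0 := by
    refine exists_lieSymmetry hI hI' hJ hμ isOpen_univ (fun _ _ _ _ => mem_univ _)
      (X := fun ε x t => x + ε * ρ t) (T := fun _ t => t) (a := fun _ _ => 1)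
      (φ := fun ε x t => ε * ρ' t * x + ε ^ 2 / 2 * (ρ t * ρ' t) - ε * σ t)
      (φ₁ := fun ε _ t => ε * ρ' t) (φ₂ := fun _ _ => 0)
      (α₀ := fun x t => -(ρ' t * x) + σ t) ?_ ?_ ?_ ?_ ?_ ?_ ?_ ?_ ?_ ?_ ?_ ?_ ?_ ?_ ?_ ?_ ?_ ?_
    · exact sρ.comp contDiff_snd
    · exact contDiff_const
    · fun_prop
    · fun_prop
    · fun_prop
    · fun_prop
    · simp
    · simp
    · simp
    · exact fun ε x t _ => (hasDerivAt_id x).add_const _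
    · exact fun ε x t _ => (((dρ t).const_mul ε).const_add x).congr_deriv (by ring)
    · exact fun ε x t _ => (hasDerivAt_id t).congr_deriv (by ring)
    · intro ε x t _
      simpa using ((((hasDerivAt_id x).const_mul (ε * ρ' t)).add_const
        (ε ^ 2 / 2 * (ρ t * ρ' t))).sub_const (ε * σ t))
    · exact fun ε x t _ => hasDerivAt_const _ _
    · intro ε x t _ hx hX
      refine (((((dρ' t).const_mul ε).mul_const x).add
        (((dρ t).mul (dρ' t)).const_mul (ε ^ 2 / 2))).sub ((dσ t).const_mul ε)).congr_deriv ?_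
      rw [hq x hx, hq _ hX]
      ring
    · exact fun ε x t _ => by simpa using ((hasDerivAt_id ε).mul_const (ρ t)).const_add x
    · exact fun ε x t _ => hasDerivAt_const _ _
    · intro ε x t _
      have h := hasDerivAt_id' ε
      refine ((((h.mul_const (ρ' t)).mul_const x).add
        (((h.pow 2).div_const 2).mul_const (ρ t * ρ' t))).sub (h.mul_const (σ t))).congr_deriv ?_
      push_cast
      ring
  refine ⟨S, fun h => hρ ?_⟩
  have := h.1 x₀ hx₀ t₀ ht₀
  rwa [hS] at this

/-! ### Inverse-square potentials: time changes -/

/-- For `q = A (x - c)² + 2 C + D / (x - c)²` the time changes `T` generated by `τ(t) ∂_t` with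
`τ''' = 4 A τ'`, together with the scalings of `x - c` by `√T_t`, are symmetries. The flow is given
through `h = 1 / T_t`; the third-order equation for `τ` is encoded as the equation
`2 h h_tt = h_t² + 4 A (h² - 1)`. The functions `τ₁, τ₂, h₁, h₂` are the derivatives of `τ` and the
time derivatives of `h`. -/
lemma exists_nontrivial_of_timeChange {μ : ℝ → ℝ} {I J : Set ℝ} (hI : IsOpen I)
    (hI' : I.OrdConnected) (hI'' : I.Nonempty) (hJ : IsOpen J) (hJ'' : J.Nonempty)
    (hμ : ContDiffOn ℝ ∞ μ I) {A C D c : ℝ}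
    (hq : ∀ x ∈ I, deriv μ x + μ x ^ 2 = A * (x - c) ^ 2 + 2 * C + D / (x - c) ^ 2)
    {τ τ₁ τ₂ : ℝ → ℝ} {T h h₁ h₂ : ℝ → ℝ → ℝ} {H : Set (ℝ × ℝ)} (hH : IsOpen H)
    (hH0 : ∀ t, ((0 : ℝ), t) ∈ H) (hpos : ∀ ε t, (ε, t) ∈ H → 0 < h ε t)
    (sτ : ContDiff ℝ ∞ τ) (sτ₁ : ContDiff ℝ ∞ τ₁) (sτ₂ : ContDiff ℝ ∞ τ₂)
    (dτ : ∀ t, HasDerivAt τ (τ₁ t) t) (dτ₁ : ∀ t, HasDerivAt τ₁ (τ₂ t) t)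
    (hne : ∀ t, τ₁ t ≠ 0 ∨ τ₂ t ≠ 0)
    (sT : ContDiffOn ℝ ∞ (fun p : ℝ × ℝ => T p.1 p.2) H)
    (sh : ContDiffOn ℝ ∞ (fun p : ℝ × ℝ => h p.1 p.2) H)
    (sh₁ : ContDiffOn ℝ ∞ (fun p : ℝ × ℝ => h₁ p.1 p.2) H)
    (T0 : ∀ t, T 0 t = t) (h0 : ∀ t, h 0 t = 1) (h₁0 : ∀ t, h₁ 0 t = 0)
    (Tt : ∀ ε t, (ε, t) ∈ H → HasDerivAt (fun s => T ε s) (1 / h ε t) t)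
    (ht : ∀ ε t, (ε, t) ∈ H → HasDerivAt (fun s => h ε s) (h₁ ε t) t)
    (h₁t : ∀ ε t, (ε, t) ∈ H → HasDerivAt (fun s => h₁ ε s) (h₂ ε t) t)
    (hode : ∀ ε t, (ε, t) ∈ H → 2 * h ε t * h₂ ε t = h₁ ε t ^ 2 + 4 * A * (h ε t ^ 2 - 1))
    (Tε : ∀ ε t, (ε, t) ∈ H → HasDerivAt (fun e => T e t) (τ (T ε t)) ε)
    (hε : ∀ ε t, (ε, t) ∈ H → HasDerivAt (fun e => h e t) (-τ₁ (T ε t) * h ε t) ε)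
    (h₁ε : ∀ ε t, (ε, t) ∈ H →
      HasDerivAt (fun e => h₁ e t) (-τ₂ (T ε t) - τ₁ (T ε t) * h₁ ε t) ε) :
    ∃ S : LieSymmetry μ I J, S.Nontrivial := by
  obtain ⟨x₀, hx₀⟩ := hI''
  obtain ⟨t₀, ht₀⟩ := hJ''
  obtain ⟨S, -, hS⟩ : ∃ S : LieSymmetry μ I J,
      S.ξ = (fun x t => τ₁ t / 2 * (x - c)) ∧ S.τ = τ := by
    set G : Set (ℝ × ℝ × ℝ) := (fun q => (q.1, q.2.2)) ⁻¹' H with hG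
    have hGo : IsOpen G := hH.preimage (by fun_prop)
    have lift : ∀ {g : ℝ → ℝ → ℝ}, ContDiffOn ℝ ∞ (fun p : ℝ × ℝ => g p.1 p.2) H →
        ContDiffOn ℝ ∞ (fun q : ℝ × ℝ × ℝ => g q.1 q.2.2) G := fun {g} hg =>
      hg.comp (f := fun q : ℝ × ℝ × ℝ => (q.1, q.2.2)) (by fun_prop) fun q hq => hq
    have hposG : ∀ q ∈ G, 0 < h q.1 q.2.2 := fun q hq => hpos _ _ hq
    have hx : ContDiffOn ℝ ∞ (fun q : ℝ × ℝ × ℝ => q.2.1 - c) G := by fun_prop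
    have hsq : ∀ ε t, (ε, t) ∈ H → 0 < √(h ε t) ∧ √(h ε t) ^ 2 = h ε t := fun ε t hp =>
      ⟨Real.sqrt_pos.2 (hpos ε t hp), Real.sq_sqrt (hpos ε t hp).le⟩
    refine exists_lieSymmetry hI hI' hJ hμ hGo (fun _ _ t _ => hH0 t)
      (X := fun ε x t => c + (x - c) / √(h ε t)) (T := T) (a := fun ε t => 1 / √(h ε t))
      (φ := fun ε x t => -(h₁ ε t / (4 * h ε t)) * (x - c) ^ 2 - Real.log (h ε t) / 4
        + C * (T ε t - t))
      (φ₁ := fun ε x t => -(h₁ ε t / (2 * h ε t)) * (x - c))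
      (φ₂ := fun ε t => -(h₁ ε t / (2 * h ε t)))
      (α₀ := fun x t => -(τ₂ t / 4 * (x - c) ^ 2) - τ₁ t / 4 - C * τ t)
      ?_ sτ ?_ ?_ ?_ ?_ ?_ ?_ ?_ ?_ ?_ ?_ ?_ ?_ ?_ ?_ ?_ ?_
    · fun_prop
    · fun_prop
    · exact contDiffOn_const.add (hx.div ((lift sh).sqrt fun q hq => (hposG q hq).ne')
        fun q hq => (Real.sqrt_pos.2 (hposG q hq)).ne')
    · exact lift sT
    · exact ((((lift sh₁).div (contDiffOn_const.mul (lift sh))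
        fun q hq => by have := hposG q hq; positivity).neg.mul (hx.pow 2)).sub
        (((lift sh).log fun q hq => (hposG q hq).ne').div_const 4)).add
        (contDiffOn_const.mul ((lift sT).sub (by fun_prop)))
    · simp [h0]
    · exact T0
    · simp [h0, h₁0, T0]
    · exact fun ε x t _ => (((hasDerivAt_id x).sub_const c).div_const _).const_add c
    · intro ε x t hp
      obtain ⟨hg, hg2⟩ := hsq ε t hp
      have d := (ht ε t hp).sqrt (hpos ε t hp).ne'
      refine ((d.fun_inv hg.ne').const_mul (x - c) |>.const_add c).congr_deriv ?_
      rw [hg2]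
      have := hpos ε t hp
      field_simp
    · intro ε x t hp
      refine (Tt ε t hp).congr_deriv ?_
      rw [div_pow, (hsq ε t hp).2, one_pow]
    · intro ε x t hp
      have d := (((hasDerivAt_id' x).sub_const c).pow 2).const_mul (-(h₁ ε t / (4 * h ε t)))
      refine ((d.sub_const (Real.log (h ε t) / 4)).add_const (C * (T ε t - t))).congr_deriv ?_
      push_cast
      ring
    · intro ε x t hp
      exact (((hasDerivAt_id' x).sub_const c).const_mul _).congr_deriv (mul_one _)
    · intro ε x t hp hx hX
      have hh := hpos ε t hp
      obtain ⟨hg, hg2⟩ := hsq ε t hp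
      have d := (((((h₁t ε t hp).div ((ht ε t hp).const_mul 4) (by positivity)).neg.mul_const
        ((x - c) ^ 2)).sub (((ht ε t hp).log hh.ne').div_const 4)).add
        (((Tt ε t hp).sub (hasDerivAt_id' t)).const_mul C))
      refine d.congr_deriv ?_
      rw [hq x hx, hq _ hX]
      have e1 : D / (c + (x - c) / √(h ε t) - c) ^ 2 = D / (x - c) ^ 2 * h ε t := by
        rw [add_sub_cancel_left, div_pow, hg2, div_div_eq_mul_div]; ring
      have e2 : (c + (x - c) / √(h ε t) - c) ^ 2 = (x - c) ^ 2 / h ε t := by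
        rw [add_sub_cancel_left, div_pow, hg2]
      have e3 : (1 / √(h ε t)) ^ 2 = 1 / h ε t := by rw [div_pow, hg2, one_pow]
      rw [e1, e2, e3]
      have ode := hode ε t hp
      generalize D / (x - c) ^ 2 = w
      generalize h ε t = k at *
      field_simp
      linear_combination -4 * (x - c) ^ 2 * ode
    · intro ε x t hp
      obtain ⟨hg, hg2⟩ := hsq ε t hp
      have d := (hε ε t hp).sqrt (hpos ε t hp).ne'
      refine ((d.fun_inv hg.ne').const_mul (x - c) |>.const_add c).congr_deriv ?_
      rw [hg2, add_sub_cancel_left]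
      have := hpos ε t hp
      field_simp
    · exact fun ε x t hp => Tε ε t hp
    · intro ε x t hp
      have hh := hpos ε t hp
      obtain ⟨hg, hg2⟩ := hsq ε t hp
      have d := (((((h₁ε ε t hp).div ((hε ε t hp).const_mul 4) (by positivity)).neg.mul_const
        ((x - c) ^ 2)).sub (((hε ε t hp).log hh.ne').div_const 4)).add
        (((Tε ε t hp).sub_const t).const_mul C))
      refine d.congr_deriv ?_
      rw [add_sub_cancel_left, div_pow, hg2]
      field_simp
      ring
  refine ⟨S, fun hS' => ?_⟩
  obtain ⟨b, hb⟩ := hS'.2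
  rw [hS] at hb
  -- `τ` is not constant on `J`: its first two derivatives do not vanish simultaneously
  have e1 : ∀ t ∈ J, τ₁ t = 0 := fun t ht => (dτ t).unique
    ((hasDerivAt_const t b).congr_of_eventuallyEq
      (by filter_upwards [hJ.mem_nhds ht] with s hs using hb s hs))
  have e2 : τ₂ t₀ = 0 := (dτ₁ t₀).unique ((hasDerivAt_const t₀ 0).congr_of_eventuallyEq
      (by filter_upwards [hJ.mem_nhds ht₀] with s hs using e1 s hs))
  exact (hne t₀).elim (fun h => h (e1 t₀ ht₀)) fun h => h e2

/-- A flow on the time line for each value of `A`: `τ = t` for `A = 0`, `τ = exp (2 k t)` for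
`A = k²` and `τ = 2 sin² (k t)` for `A = -k²`. -/
lemma exists_nontrivial_of_inverseSquare {μ : ℝ → ℝ} {I J : Set ℝ} (hI : IsOpen I)
    (hI' : I.OrdConnected) (hI'' : I.Nonempty) (hJ : IsOpen J) (hJ'' : J.Nonempty)
    (hμ : ContDiffOn ℝ ∞ μ I) {A C D c : ℝ}
    (hq : ∀ x ∈ I, deriv μ x + μ x ^ 2 = A * (x - c) ^ 2 + 2 * C + D / (x - c) ^ 2) :
    ∃ S : LieSymmetry μ I J, S.Nontrivial := by
  rcases lt_trichotomy A 0 with hA | rfl | hA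
  · obtain ⟨k, hk, rfl⟩ : ∃ k : ℝ, k ≠ 0 ∧ A = -k ^ 2 :=
      ⟨√(-A), (Real.sqrt_pos.2 (by linarith)).ne', by rw [Real.sq_sqrt (by linarith)]; ring⟩
    have hl : ∀ t, HasDerivAt (fun t => k * t) k t := fun t => by
      simpa using (hasDerivAt_id t).const_mul k
    have hs : ∀ t, HasDerivAt (fun t => Real.sin (k * t)) (Real.cos (k * t) * k) t :=
      fun t => (hl t).sin
    have hc : ∀ t, HasDerivAt (fun t => Real.cos (k * t)) (-Real.sin (k * t) * k) t :=
      fun t => (hl t).cos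
    have hsc : ∀ t, Real.sin (k * t) ^ 2 + Real.cos (k * t) ^ 2 = 1 := fun t =>
      Real.sin_sq_add_cos_sq _
    -- the flow moves the point `exp (i k t)` to the direction of `(w + i y) exp (i k t)`
    set y : ℝ → ℝ → ℝ := fun ε t => 2 * k * ε * Real.sin (k * t) ^ 2 with hy
    set w : ℝ → ℝ → ℝ := fun ε t => 1 - 2 * k * ε * (Real.sin (k * t) * Real.cos (k * t)) with hw
    set h : ℝ → ℝ → ℝ := fun ε t => w ε t ^ 2 + y ε t ^ 2 with hh
    set T : ℝ → ℝ → ℝ := fun ε t => t + Real.arctan (y ε t / w ε t) / k with hT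
    set H : Set (ℝ × ℝ) := {p | 0 < w p.1 p.2} with hH
    have hwpos : ∀ ε t, (ε, t) ∈ H → 0 < w ε t := fun ε t hp => hp
    have hpos : ∀ ε t, (ε, t) ∈ H → 0 < h ε t := fun ε t hp => by
      have := hwpos ε t hp
      positivity
    have hh' : ∀ ε t, h ε t = 1 - 4 * k * ε * (Real.sin (k * t) * Real.cos (k * t))
        + 4 * k ^ 2 * ε ^ 2 * Real.sin (k * t) ^ 2 := fun ε t => by
      simp only [hh, hw, hy]
      linear_combination (4 * k ^ 2 * ε ^ 2 * Real.sin (k * t) ^ 2) * hsc t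
    have sw : ContDiff ℝ ∞ fun p : ℝ × ℝ => w p.1 p.2 := by fun_prop
    have sy : ContDiff ℝ ∞ fun p : ℝ × ℝ => y p.1 p.2 := by fun_prop
    -- sine and cosine of `k T`
    have hkT : ∀ ε t, k * T ε t = k * t + Real.arctan (y ε t / w ε t) := fun ε t => by
      simp only [hT]; field_simp
    have hsqrt : ∀ ε t, (ε, t) ∈ H →
        √(1 + (y ε t / w ε t) ^ 2) = √(h ε t) / w ε t := fun ε t hp => by
      have h1 := hwpos ε t hp
      rw [← Real.sqrt_sq h1.le, ← Real.sqrt_div (hpos ε t hp).le, Real.sqrt_sq h1.le]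
      congr 1
      simp only [hh]
      field_simp
    have hsinT : ∀ ε t, (ε, t) ∈ H →
        Real.sin (k * T ε t) = Real.sin (k * t) / √(h ε t) := fun ε t hp => by
      have h1 := hwpos ε t hp
      have h2 := Real.sqrt_pos.2 (hpos ε t hp)
      rw [hkT, Real.sin_add, Real.cos_arctan, Real.sin_arctan, hsqrt ε t hp]
      field_simp
      simp only [hw, hy]
      ring
    have hcosT : ∀ ε t, (ε, t) ∈ H → Real.cos (k * T ε t) =
        (Real.cos (k * t) - 2 * k * ε * Real.sin (k * t)) / √(h ε t) := fun ε t hp => by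
      have h1 := hwpos ε t hp
      have h2 := Real.sqrt_pos.2 (hpos ε t hp)
      rw [hkT, Real.cos_add, Real.cos_arctan, Real.sin_arctan, hsqrt ε t hp]
      field_simp
      simp only [hw, hy]
      linear_combination (-2 * k * ε * Real.sin (k * t)) * hsc t
    have hsq : ∀ ε t, (ε, t) ∈ H → √(h ε t) ^ 2 = h ε t := fun ε t hp =>
      Real.sq_sqrt (hpos ε t hp).le
    have dT : ∀ {u v : ℝ → ℝ} {u' v' z : ℝ}, HasDerivAt u u' z → HasDerivAt v v' z → 0 < v z →
        HasDerivAt (fun s => Real.arctan (u s / v s) / k)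
          ((u' * v z - u z * v') / (v z ^ 2 + u z ^ 2) / k) z := by
      intro u v u' v' z hu hv hz
      refine ((hu.div hv hz.ne').arctan.div_const k).congr_deriv ?_
      have : 0 < v z ^ 2 + u z ^ 2 := by positivity
      simp only [Pi.div_apply]
      field_simp
    have yt : ∀ ε t, HasDerivAt (fun s => y ε s)
        (4 * k ^ 2 * ε * (Real.sin (k * t) * Real.cos (k * t))) t := fun ε t =>
      (((hs t).pow 2).const_mul (2 * k * ε)).congr_deriv (by push_cast; ring)
    have wt : ∀ ε t, HasDerivAt (fun s => w ε s)
        (-(2 * k ^ 2 * ε * (Real.cos (k * t) ^ 2 - Real.sin (k * t) ^ 2))) t := fun ε t =>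
      ((((hs t).mul (hc t)).const_mul (2 * k * ε)).const_sub 1).congr_deriv (by ring)
    have yε : ∀ ε t, HasDerivAt (fun e => y e t) (2 * k * Real.sin (k * t) ^ 2) ε := fun ε t =>
      (((hasDerivAt_id' ε).const_mul (2 * k)).mul_const _).congr_deriv (by ring)
    have wε : ∀ ε t, HasDerivAt (fun e => w e t)
        (-(2 * k * (Real.sin (k * t) * Real.cos (k * t)))) ε := fun ε t =>
      ((((hasDerivAt_id' ε).const_mul (2 * k)).mul_const _).const_sub 1).congr_deriv (by ring)
    refine exists_nontrivial_of_timeChange hI hI' hI'' hJ hJ'' hμ hq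
      (τ := fun t => 2 * Real.sin (k * t) ^ 2)
      (τ₁ := fun t => 4 * k * (Real.sin (k * t) * Real.cos (k * t)))
      (τ₂ := fun t => 4 * k ^ 2 * (Real.cos (k * t) ^ 2 - Real.sin (k * t) ^ 2))
      (T := T) (h := h) (H := H)
      (h₁ := fun ε t => -(4 * k ^ 2 * ε * (Real.cos (k * t) ^ 2 - Real.sin (k * t) ^ 2))
        + 8 * k ^ 3 * ε ^ 2 * (Real.sin (k * t) * Real.cos (k * t)))
      (h₂ := fun ε t => 16 * k ^ 3 * ε * (Real.sin (k * t) * Real.cos (k * t))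
        + 8 * k ^ 4 * ε ^ 2 * (Real.cos (k * t) ^ 2 - Real.sin (k * t) ^ 2))
      ?_ ?_ hpos (by fun_prop) (by fun_prop) (by fun_prop) ?_ ?_ ?_ ?_ ?_ ?_ ?_ ?_ ?_ ?_ ?_ ?_ ?_
      ?_ ?_ ?_
    · exact isOpen_lt continuous_const sw.continuous
    · simp [hH, hw]
    · exact fun t => (((hs t).pow 2).const_mul 2).congr_deriv (by push_cast; ring)
    · exact fun t => (((hs t).mul (hc t)).const_mul (4 * k)).congr_deriv (by ring)
    · intro t
      by_contra! hcon
      have h1 := hcon.1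
      have h2 := hcon.2
      have h1' : Real.sin (k * t) * Real.cos (k * t) = 0 := by simpa [hk] using h1
      have h2' : Real.cos (k * t) ^ 2 - Real.sin (k * t) ^ 2 = 0 := by simpa [hk] using h2
      have h3 := hsc t
      nlinarith
    · exact contDiff_snd.contDiffOn.add (((sy.contDiffOn.div sw.contDiffOn
        fun p hp => (hwpos p.1 p.2 hp).ne').arctan).div_const k)
    · exact ((sw.pow 2).add (sy.pow 2)).contDiffOn
    · fun_prop
    · simp [hT, hy]
    · simp [hh, hy, hw]
    · simp
    · intro ε t hp
      refine ((hasDerivAt_id' t).add (dT (yt ε t) (wt ε t) (hwpos ε t hp))).congr_deriv ?_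
      change 1 + _ / h ε t / k = _
      have h1 := hpos ε t hp
      field_simp
      rw [hh']
      simp only [hy, hw]
      linear_combination (-4 * k ^ 2 * ε ^ 2 * Real.sin (k * t) ^ 2) * hsc t
    · intro ε t hp
      rw [show (fun s => h ε s) = fun s => _ from funext (hh' ε)]
      refine (((((hs t).mul (hc t)).const_mul (4 * k * ε)).const_sub 1).add
        (((hs t).pow 2).const_mul (4 * k ^ 2 * ε ^ 2))).congr_deriv ?_
      push_cast
      ring
    · intro ε t hp
      refine ((((((hc t).pow 2).sub ((hs t).pow 2)).const_mul (4 * k ^ 2 * ε)).neg).add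
        (((hs t).mul (hc t)).const_mul (8 * k ^ 3 * ε ^ 2))).congr_deriv ?_
      push_cast
      ring
    · intro ε t hp
      have e : Real.cos (k * t) ^ 2 = 1 - Real.sin (k * t) ^ 2 := by
        linear_combination hsc t
      rw [hh']
      ring_nf
      have e3 : Real.cos (k * t) ^ 3 = Real.cos (k * t) * (1 - Real.sin (k * t) ^ 2) := by
        rw [← e]; ring
      have e4 : Real.cos (k * t) ^ 4 = (1 - Real.sin (k * t) ^ 2) ^ 2 := by
        rw [← e]; ring
      simp only [e, e3, e4]
      ring
    · intro ε t hp
      refine ((dT (yε ε t) (wε ε t) (hwpos ε t hp)).const_add t).congr_deriv ?_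
      change _ / h ε t / k = _
      rw [hsinT ε t hp, div_pow, hsq ε t hp]
      have h1 := hpos ε t hp
      field_simp
      simp only [hy, hw]
      ring
    · intro ε t hp
      have h1 := hpos ε t hp
      rw [show (fun e => h e t) = fun e => _ from funext fun e => hh' e t]
      have d := hasDerivAt_id' ε
      refine ((((d.const_mul (4 * k)).mul_const _).const_sub 1).add
        (((d.pow 2).const_mul (4 * k ^ 2)).mul_const _)).congr_deriv ?_
      rw [hsinT ε t hp, hcosT ε t hp, div_mul_div_comm, ← sq, hsq ε t hp]
      field_simp
      push_cast
      ring
    · intro ε t hp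
      have h1 := hpos ε t hp
      have d := hasDerivAt_id' ε
      refine (((d.const_mul (4 * k ^ 2)).mul_const _).neg.add
        (((d.pow 2).const_mul (8 * k ^ 3)).mul_const _)).congr_deriv ?_
      rw [hsinT ε t hp, hcosT ε t hp, div_mul_div_comm, div_pow, div_pow, ← sq, hsq ε t hp]
      have e : Real.cos (k * t) ^ 2 = 1 - Real.sin (k * t) ^ 2 := by
        linear_combination hsc t
      push_cast
      field_simp
      rw [hh']
      ring_nf
      have e3 : Real.cos (k * t) ^ 3 = Real.cos (k * t) * (1 - Real.sin (k * t) ^ 2) := by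
        rw [← e]; ring
      simp only [e, e3]
      ring
  · refine exists_nontrivial_of_timeChange hI hI' hI'' hJ hJ'' hμ hq (H := univ)
      (τ := fun t => t) (τ₁ := fun _ => 1) (τ₂ := fun _ => 0)
      (T := fun ε t => Real.exp ε * t) (h := fun ε _ => Real.exp (-ε)) (h₁ := fun _ _ => 0)
      (h₂ := fun _ _ => 0) isOpen_univ (fun _ => mem_univ _) (fun _ _ _ => Real.exp_pos _)
      (by fun_prop) (by fun_prop) (by fun_prop) (fun t => hasDerivAt_id t)
      (fun t => hasDerivAt_const _ _) (by simp) (by fun_prop) (by fun_prop) (by fun_prop)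
      (by simp) (by simp) (by simp) ?_ (fun ε t _ => hasDerivAt_const _ _)
      (fun ε t _ => hasDerivAt_const _ _) (by simp) ?_ ?_ ?_
    · intro ε t _
      exact ((hasDerivAt_id' t).const_mul (Real.exp ε)).congr_deriv (by simp [Real.exp_neg])
    · exact fun ε t _ => (Real.hasDerivAt_exp ε).mul_const t
    · exact fun ε t _ => ((hasDerivAt_id' ε).neg.exp).congr_deriv (by simp)
    · exact fun ε t _ => (hasDerivAt_const _ _).congr_deriv (by simp)
  · obtain ⟨k, hk, rfl⟩ : ∃ k : ℝ, k ≠ 0 ∧ A = k ^ 2 :=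
      ⟨√A, (Real.sqrt_pos.2 hA).ne', (Real.sq_sqrt hA.le).symm⟩
    set E : ℝ → ℝ := fun t => Real.exp (2 * k * t) with hE
    have dE : ∀ t, HasDerivAt E (2 * k * E t) t := fun t =>
      (((hasDerivAt_id' t).const_mul (2 * k)).exp).congr_deriv (by simp only [hE]; ring)
    have sE : ContDiff ℝ ∞ E := by fun_prop
    set h : ℝ → ℝ → ℝ := fun ε t => 1 - 2 * k * ε * E t with hh
    set T : ℝ → ℝ → ℝ := fun ε t => t - Real.log (h ε t) / (2 * k) with hT
    set H : Set (ℝ × ℝ) := {p | 0 < h p.1 p.2} with hH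
    have sh : ContDiff ℝ ∞ fun p : ℝ × ℝ => h p.1 p.2 := by fun_prop
    have hpos : ∀ ε t, (ε, t) ∈ H → 0 < h ε t := fun ε t hp => hp
    have hET : ∀ ε t, (ε, t) ∈ H → E (T ε t) = E t / h ε t := fun ε t hp => by
      simp only [hE, hT]
      rw [mul_sub, mul_div_cancel₀ _ (by positivity), Real.exp_sub, Real.exp_log (hpos ε t hp)]
    have ht : ∀ ε t, HasDerivAt (fun s => h ε s) (-(4 * k ^ 2 * ε * E t)) t := fun ε t =>
      (((dE t).const_mul (2 * k * ε)).const_sub 1).congr_deriv (by ring)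
    have hε : ∀ ε t, HasDerivAt (fun e => h e t) (-(2 * k * E t)) ε := fun ε t =>
      ((((hasDerivAt_id' ε).const_mul (2 * k)).mul_const (E t)).const_sub 1).congr_deriv (by ring)
    refine exists_nontrivial_of_timeChange hI hI' hI'' hJ hJ'' hμ hq (H := H)
      (τ := E) (τ₁ := fun t => 2 * k * E t) (τ₂ := fun t => 4 * k ^ 2 * E t) (T := T) (h := h)
      (h₁ := fun ε t => -(4 * k ^ 2 * ε * E t)) (h₂ := fun ε t => -(8 * k ^ 3 * ε * E t))
      ?_ ?_ hpos sE (by fun_prop) (by fun_prop) dE ?_ ?_ ?_ sh.contDiffOn (by fun_prop) ?_ ?_ ?_ ?_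
      (fun ε t _ => ht ε t) ?_ ?_ ?_ ?_ ?_
    · exact isOpen_lt continuous_const sh.continuous
    · simp [hH, hh]
    · exact fun t => ((dE t).const_mul (2 * k)).congr_deriv (by ring)
    · exact fun t => Or.inl (mul_ne_zero (by positivity) (Real.exp_pos _).ne')
    · exact contDiff_snd.contDiffOn.sub ((sh.contDiffOn.log
        fun p hp => (hpos p.1 p.2 hp).ne').div_const (2 * k))
    · simp [hT, hh]
    · simp [hh]
    · simp
    · intro ε t hp
      have h1 := hpos ε t hp
      refine ((hasDerivAt_id' t).sub (((ht ε t).log h1.ne').div_const (2 * k))).congr_deriv ?_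
      field_simp
      simp only [hh]
      ring
    · exact fun ε t hp => ((dE t).const_mul (4 * k ^ 2 * ε)).neg.congr_deriv (by ring)
    · intro ε t hp
      simp only [hh]
      ring
    · intro ε t hp
      have h1 := hpos ε t hp
      refine ((((hε ε t).log h1.ne').div_const (2 * k)).const_sub t).congr_deriv ?_
      rw [hET ε t hp]
      field_simp
    · intro ε t hp
      have h1 := hpos ε t hp
      refine (hε ε t).congr_deriv ?_
      rw [hET ε t hp]
      field_simp
    · intro ε t hp
      have h1 := hpos ε t hp
      refine (((hasDerivAt_id' ε).const_mul (4 * k ^ 2)).mul_const (E t)).neg.congr_deriv ?_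
      rw [hET ε t hp]
      field_simp
      simp only [hh]
      ring

/-! ### The Riccati equations -/

theorem theorem3 (μ : ℝ → ℝ) (I J : Set ℝ)
    (hI : IsOpen I) (hI' : I.OrdConnected) (hI'' : I.Nonempty)
    (hJ : IsOpen J) (hJ' : J.OrdConnected) (hJ'' : J.Nonempty)
    (hμ : ContDiffOn ℝ ∞ μ I) :
    (∃ S : LieSymmetry μ I J, S.Nontrivial) ↔
      ∃ c : ℝ, SolvesRiccati (fun y => μ (y + c)) {y | y + c ∈ I} := by
  have hshift : ∀ c y, deriv (fun y => μ (y + c)) y = deriv μ (y + c) := fun c y =>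
    deriv_comp_add_const μ c y
  constructor
  · rintro ⟨S, hS⟩
    rcases hS.riccati hI hI' hI'' hJ hJ' hμ with ⟨A, B, C, h⟩ | ⟨c, A, C, D, hc, h⟩
    · refine ⟨0, Or.inr (Or.inl ⟨A, B, C, fun y hy => ?_⟩)⟩
      simpa [hshift] using h (y + 0) hy
    · refine ⟨c, Or.inr (Or.inr (Or.inr ⟨A, C, D, Or.inr (by simpa using hc), fun y hy => ?_⟩))⟩
      simpa [hshift] using h (y + c) hy
  · rintro ⟨c, h⟩
    have quad : ∀ A B C : ℝ, (∀ y, y + c ∈ I →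
        deriv μ (y + c) + μ (y + c) ^ 2 = A * y ^ 2 + 4 * B * y + 2 * C) →
        ∃ S : LieSymmetry μ I J, S.Nontrivial := fun A B C h =>
      exists_nontrivial_of_quadratic hI hI' hI'' hJ hJ'' hμ (A := A) (B := B - A * c / 2)
        (C := C - 2 * B * c + A * c ^ 2 / 2) fun x hx => by
          have := h (x - c) (by simpa using hx)
          rw [sub_add_cancel] at this
          rw [this]
          ring
    have inv : ∀ A C D : ℝ, (∀ y, y + c ∈ I →
        deriv μ (y + c) + μ (y + c) ^ 2 = A * y ^ 2 + 2 * C + D / y ^ 2) →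
        ∃ S : LieSymmetry μ I J, S.Nontrivial := fun A C D h =>
      exists_nontrivial_of_inverseSquare hI hI' hI'' hJ hJ'' hμ (A := A) (C := C) (D := D)
        (c := c) fun x hx => by
          have := h (x - c) (by simpa using hx)
          rwa [sub_add_cancel] at this
    rcases h with ⟨B, C, h⟩ | ⟨A, B, C, h⟩ | ⟨C, D, -, h⟩ | ⟨A, C, D, -, h⟩ <;>
      simp only [hshift, mem_ofPred_eq] at h
    · exact quad 0 B C fun y hy => by rw [h y hy]; ring
    · exact quad A B C h
    · exact inv 0 C D fun y hy => by rw [h y hy]; ring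
    · exact inv A C D h
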